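/- Let $A$ be a finite alphabet, let $A^+$ be the set of nonempty finite words over $A$, let $p\ge 2$, and let $\tau:A\to A^+$ be a substitution of constant length $p$ (that is, $|\tau(a)|=p$ for all $a\in A$), extended to words by concatenation. Suppose that $\tau$ is one-to-one ($\tau(a)\ne\tau(b)$ whenever $a\neq b$) and primitive (there is $n\in\mathbb N$ such that every letter $a$ appears in $\tau^n(b)$ for every letter $b$). Give $A^{\mathbb Z}$ the product of the discrete topologies. Let $X_\tau\subseteq A^{\mathbb Z}$ be the subshift generated by $\tau$, that is, the smallest closed shift-invariant set in which all the words $\tau^n(a)$ ($n\in\mathbb N$, $a\in A$) appear; equivalently, $X_\tau$ is the set of two-sided sequences all of whose finite sub-words are sub-words of words $\tau^n(a)$. Suppose that $X_\tau$ is infinite. Let $T$ be the shift homeomorphism of $X_\tau$ and let $\varrho$ be any metric on $X_\tau$ that induces its topology. A pair $(x,y)\in X_\tau\times X_\tau$ is a Li–Yorke pair if $\limsup_{n\to\infty}\varrho(T^nx,T^ny)>0$ and $\liminf_{n\to\infty}\varrho(T^nx,T^ny)=0$. It is a strong Li–Yorke pair if moreover it is recurrent under $T\times T$: for every neighbourhood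 $U$ of $(x,y)$ there are infinitely many $n\in\mathbb N$ with $(T^nx,T^ny)\in U$. A (strong) Li–Yorke orbit is the orbit $\{(T^nx,T^ny):n\in\mathbb Z\}$ of a (strong) Li–Yorke pair. Two words $s,s'$ of the same length have a coincidence if $s_i=s'_i$ for some coordinate $i$. Then the following statements are equivalent: 1. $(X_\tau,T)$ has uncountably many Li–Yorke pairs; 2. $(X_\tau,T)$ has infinitely many Li–Yorke orbits; 3. $(X_\tau,T)$ has at least one strong Li–Yorke pair; 4. $(X_\tau,T)$ has uncountably many strong Li–Yorke orbits; 5. there exist $m\in\mathbb N$, letters $a\neq b$ in $A$ and (possibly empty) words $u,v,w,u',v',w'$ over $A$ with $|u|=|u'|$, $|v|=|v'|$, $|w|=|w'|$ such that $\tau^m(a)=uavaw$, $\tau^m(b)=u'bv'bw'$, and the words $vaw$ and $v'bw'$ have a coincidence. -/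

import Mathlib

open Filter Topology

/-! ### Pairs in a topological dynamical system -/

namespace LiYorke

variable {X : Type*}

/-- `(x, y)` is a Li–Yorke pair of `(X, T)`: `limsup ρ(Tⁿx, Tⁿy) > 0` and
`liminf ρ(Tⁿx, Tⁿy) = 0`. The distance is read in `[0, ∞]`, where the upper and lower limits
always exist. -/
def IsLiYorkePair [MetricSpace X] (T : X → X) (z : X × X) : Prop :=
  0 < limsup (fun n : ℕ => edist (T^[n] z.1) (T^[n] z.2)) atTop ∧
    liminf (fun n : ℕ => edist (T^[n] z.1) (T^[n] z.2)) atTop = 0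

/-- `z` is a recurrent point of `f`: its forward orbit returns infinitely often to each of its
neighbourhoods. -/
def IsRecurrentPt [TopologicalSpace X] (f : X → X) (z : X) : Prop :=
  ∀ U ∈ 𝓝 z, ∃ᶠ n : ℕ in atTop, f^[n] z ∈ U

/-- A strong Li–Yorke pair is a Li–Yorke pair that is recurrent under `T × T`. -/
def IsStrongLiYorkePair [MetricSpace X] (T : X → X) (z : X × X) : Prop :=
  IsLiYorkePair T z ∧ IsRecurrentPt (Prod.map T T) z

/-- The set of Li–Yorke pairs of `(X, T)`. -/
def liYorkePairs [MetricSpace X] (T : Equiv.Perm X) : Set (X × X) :=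
  {z | IsLiYorkePair T z}

/-- The set of strong Li–Yorke pairs of `(X, T)`. -/
def strongLiYorkePairs [MetricSpace X] (T : Equiv.Perm X) : Set (X × X) :=
  {z | IsStrongLiYorkePair T z}

/-- The orbit of a pair under the invertible map `T × T`. -/
def pairOrbit (T : Equiv.Perm X) (z : X × X) : Set (X × X) :=
  Set.range fun n : ℤ => ((T ^ n) z.1, (T ^ n) z.2)

/-- The set of orbits of Li–Yorke pairs. -/
def liYorkeOrbits [MetricSpace X] (T : Equiv.Perm X) : Set (Set (X × X)) :=
  pairOrbit T '' liYorkePairs T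

/-- The set of orbits of strong Li–Yorke pairs. -/
def strongLiYorkeOrbits [MetricSpace X] (T : Equiv.Perm X) : Set (Set (X × X)) :=
  pairOrbit T '' strongLiYorkePairs T

end LiYorke

/-! ### Substitutions and their subshifts -/

namespace Subst

variable {A : Type*}

/-- The extension of a substitution to words, by concatenation. -/
def onWord (τ : A → List A) (w : List A) : List A := w.flatMap τ

/-- The word `τⁿ(a)`. -/
def iter (τ : A → List A) (n : ℕ) (a : A) : List A := (onWord τ)^[n] [a]

/-- `τ` has constant length `p`. -/
def HasConstLength (τ : A → List A) (p : ℕ) : Prop := ∀ a, (τ a).length = p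

/-- `τ` is primitive: for some `n`, each letter appears in `τⁿ(b)` for each letter `b`. -/
def IsPrimitive (τ : A → List A) : Prop := ∃ n : ℕ, ∀ a b : A, a ∈ iter τ n b

/-- The two words, thought of as being of the same length, agree at some coordinate. -/
def HaveCoincidence (u u' : List A) : Prop :=
  ∃ (i : ℕ) (h : i < u.length) (h' : i < u'.length), u[i] = u'[i]

/-- There are `m` and letters `a ≠ b` with `τᵐ(a) = u a v a w`, `τᵐ(b) = u' b v' b w'`, where
`|u| = |u'|`, `|v| = |v'|`, `|w| = |w'|`, and `v a w`, `v' b w'` have a coincidence. -/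
def DoubleReturnCondition (τ : A → List A) : Prop :=
  ∃ (m : ℕ) (a b : A), a ≠ b ∧ ∃ u v w u' v' w' : List A,
    iter τ m a = u ++ [a] ++ v ++ [a] ++ w ∧
    iter τ m b = u' ++ [b] ++ v' ++ [b] ++ w' ∧
    u.length = u'.length ∧ v.length = v'.length ∧ w.length = w'.length ∧
    HaveCoincidence (v ++ [a] ++ w) (v' ++ [b] ++ w')

/-- The word `x_i x_{i+1} … x_{i+n-1}` of a two-sided sequence. -/
def factor (x : ℤ → A) (i : ℤ) (n : ℕ) : List A := List.ofFn fun j : Fin n => x (i + (j : ℕ))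

/-- The shift map on two-sided sequences. -/
def fullShift (A : Type*) : Equiv.Perm (ℤ → A) where
  toFun x := fun i => x (i + 1)
  invFun x := fun i => x (i - 1)
  left_inv x := by funext i; simp
  right_inv x := by funext i; simp

/-- The subshift generated by `τ`: the two-sided sequences all of whose finite sub-words are
sub-words of some `τᵏ(a)`. For primitive `τ` of constant length at least two, it is the smallest
subshift in which all words `τᵏ(a)` appear; see `isLeast_subshift`. -/
def subshift (τ : A → List A) : Set (ℤ → A) :=
  {x | ∀ (i : ℤ) (n : ℕ), ∃ (k : ℕ) (a : A), factor x i n <:+: iter τ k a}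

lemma factor_fullShift (x : ℤ → A) (i : ℤ) (n : ℕ) :
    factor (fullShift A x) i n = factor x (i + 1) n := by
  unfold factor fullShift
  congr 1
  funext j
  change x _ = x _
  congr 1
  ring

lemma fullShift_mem_subshift_iff (τ : A → List A) (x : ℤ → A) :
    fullShift A x ∈ subshift τ ↔ x ∈ subshift τ := by
  constructor
  · intro h i n
    have := h (i - 1) n
    rwa [factor_fullShift, sub_add_cancel] at this
  · intro h i n
    rw [factor_fullShift]
    exact h (i + 1) n

/-- The shift map on the subshift generated by `τ`. -/
def shift (τ : A → List A) : Equiv.Perm (subshift τ) :=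
  (fullShift A).subtypePerm (fullShift_mem_subshift_iff τ)

/-- A subshift: a closed shift-invariant set of two-sided sequences. -/
def IsSubshift [TopologicalSpace A] (S : Set (ℤ → A)) : Prop :=
  IsClosed S ∧ fullShift A ⁻¹' S = S

/-- The word `w` appears in some point of `S`. -/
def AppearsIn (w : List A) (S : Set (ℤ → A)) : Prop :=
  ∃ x ∈ S, ∃ i : ℤ, factor x i w.length = w

lemma getElem_factor (x : ℤ → A) (i : ℤ) (n j : ℕ) (h : j < (factor x i n).length) :
    (factor x i n)[j] = x (i + j) := by
  simp [factor]

lemma length_factor (x : ℤ → A) (i : ℤ) (n : ℕ) : (factor x i n).length = n := by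
  simp [factor]

lemma factor_eq_iff (x : ℤ → A) (i : ℤ) (w : List A) :
    factor x i w.length = w ↔ ∀ (j : ℕ) (h : j < w.length), x (i + j) = w[j] := by
  constructor
  · intro h j hj
    rw [← getElem_factor x i w.length j (by rwa [length_factor])]
    simp [h]
  · intro h
    apply List.ext_getElem (length_factor _ _ _)
    intro j h1 h2
    rw [getElem_factor, h j h2]

lemma factor_congr {x y : ℤ → A} {i : ℤ} {n : ℕ} (h : ∀ j : ℕ, j < n → x (i + j) = y (i + j)) :
    factor x i n = factor y i n := by
  unfold factor
  congr 1
  funext j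
  exact h j j.2

lemma factor_infix (x : ℤ → A) (i : ℤ) (n r m : ℕ) (h : r + m ≤ n) :
    factor x (i + r) m <:+: factor x i n := by
  refine List.infix_iff_getElem?.2 ⟨r, by simpa [length_factor, add_comm] using h, ?_⟩
  intro j hj
  rw [length_factor] at hj
  rw [List.getElem?_eq_getElem (by rw [length_factor]; omega), getElem_factor, getElem_factor]
  congr 2
  push_cast
  ring

lemma onWord_append (τ : A → List A) (u v : List A) :
    onWord τ (u ++ v) = onWord τ u ++ onWord τ v := by
  simp [onWord]

lemma onWord_iterate_append (τ : A → List A) (n : ℕ) (u v : List A) :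
    (onWord τ)^[n] (u ++ v) = (onWord τ)^[n] u ++ (onWord τ)^[n] v := by
  induction n generalizing u v with
  | zero => rfl
  | succ n ih => simp only [Function.iterate_succ, Function.comp, onWord_append, ih]

lemma length_onWord {τ : A → List A} {p : ℕ} (h : HasConstLength τ p) (w : List A) :
    (onWord τ w).length = w.length * p := by
  induction w with
  | nil => simp [onWord]
  | cons a w ih =>
    have : onWord τ (a :: w) = τ a ++ onWord τ w := by simp [onWord]
    rw [this, List.length_append, ih, h a, List.length_cons]
    ring

lemma length_onWord_iterate {τ : A → List A} {p : ℕ} (h : HasConstLength τ p) (n : ℕ)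
    (w : List A) : ((onWord τ)^[n] w).length = w.length * p ^ n := by
  induction n generalizing w with
  | zero => simp
  | succ n ih =>
    rw [Function.iterate_succ_apply, ih, length_onWord h]
    ring

/-- Each `τⁿ(a)` occurs, with arbitrarily long margins on both sides, in some `τᵏ(b)`. -/
lemma exists_margins {τ : A → List A} {p : ℕ} (hp : 2 ≤ p) (hlen : HasConstLength τ p)
    (hprim : IsPrimitive τ) (n : ℕ) (a : A) (L : ℕ) :
    ∃ (k : ℕ) (b : A) (l r : List A),
      iter τ k b = l ++ iter τ n a ++ r ∧ L ≤ l.length ∧ L ≤ r.length := by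
  obtain ⟨K, hK⟩ := hprim
  have hM : 2 * L + 1 < p ^ (2 * L + 1) :=
    lt_of_lt_of_le Nat.lt_two_pow_self (Nat.pow_le_pow_left hp _)
  set M := 2 * L + 1 with hMdef
  have hlenM : (iter τ M a).length = p ^ M := by
    simp [iter, length_onWord_iterate hlen]
  have hL : L < (iter τ M a).length := by omega
  set d := (iter τ M a)[L] with hd
  have hsplit : iter τ M a = (iter τ M a).take L ++ [d] ++ (iter τ M a).drop (L + 1) := by
    simp [hd]
  obtain ⟨l₁, r₁, h₁⟩ := List.append_of_mem (hK a d)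
  have hge : ∀ (q : ℕ) (w : List A), w.length ≤ ((onWord τ)^[q] w).length := by
    intro q w
    rw [length_onWord_iterate hlen]
    exact Nat.le_mul_of_pos_right _ (Nat.pow_pos (by omega))
  refine ⟨n + K + M, a, (onWord τ)^[n + K] ((iter τ M a).take L) ++ (onWord τ)^[n] l₁,
    (onWord τ)^[n] r₁ ++ (onWord τ)^[n + K] ((iter τ M a).drop (L + 1)), ?_, ?_, ?_⟩
  · have e1 : iter τ (n + K + M) a = (onWord τ)^[n + K] (iter τ M a) := by
      simp only [iter, Function.iterate_add_apply]
    have e2 : (onWord τ)^[n + K] [d] =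
        (onWord τ)^[n] l₁ ++ iter τ n a ++ (onWord τ)^[n] r₁ := by
      have h₂ : (onWord τ)^[K] [d] = l₁ ++ [a] ++ r₁ := by
        rw [show (onWord τ)^[K] [d] = iter τ K d from rfl, h₁]; simp
      rw [Function.iterate_add_apply, h₂, onWord_iterate_append, onWord_iterate_append]
      rfl
    rw [e1]
    conv_lhs => rw [hsplit]
    rw [onWord_iterate_append, onWord_iterate_append, e2]
    simp only [List.append_assoc]
  · have := hge (n + K) ((iter τ M a).take L)
    rw [List.length_take] at this
    rw [List.length_append]
    omega
  · have := hge (n + K) ((iter τ M a).drop (L + 1))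
    rw [List.length_drop] at this
    rw [List.length_append]
    omega

lemma isOpen_agree [TopologicalSpace A] [DiscreteTopology A] (x : ℤ → A) (i : ℤ) (n : ℕ) :
    IsOpen {y : ℤ → A | ∀ j : ℕ, j < n → y (i + j) = x (i + j)} := by
  have : {y : ℤ → A | ∀ j : ℕ, j < n → y (i + j) = x (i + j)} =
      ⋂ j ∈ Finset.range n, (fun y : ℤ → A => y (i + j)) ⁻¹' {x (i + j)} := by
    ext y; simp
  rw [this]
  exact isOpen_biInter_finset fun j _ => (isOpen_discrete _).preimage (continuous_apply _)

lemma isClosed_subshift [TopologicalSpace A] [DiscreteTopology A] (τ : A → List A) :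
    IsClosed (subshift τ) := by
  rw [← isOpen_compl_iff, isOpen_iff_mem_nhds]
  intro x hx
  simp only [subshift, Set.mem_compl_iff, Set.mem_ofPred_eq, not_forall] at hx
  obtain ⟨i, n, h⟩ := hx
  filter_upwards [(isOpen_agree x i n).mem_nhds (fun j _ => rfl)] with y hy hmem
  apply h
  rw [← factor_congr hy]
  exact hmem i n

lemma iterate_preimage {S : Set (ℤ → A)} (hS : fullShift A ⁻¹' S = S) (y : ℤ → A) (hy : y ∈ S)
    (s : ℤ) : (fun j => y (j + s)) ∈ S := by
  have hn : ∀ z : ℤ → A, z ∈ S ↔ (fun j => z (j + 1)) ∈ S := by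
    intro z
    conv_lhs => rw [← hS]
    rfl
  induction s with
  | zero => simpa using hy
  | succ i ih =>
    have := (hn _).1 ih
    refine cast ?_ this
    congr 1; funext j; congr 1; ring
  | pred i ih =>
    rw [hn]
    refine cast ?_ ih
    congr 1; funext j; congr 1; ring

/-- Among the subshifts in which all words `τⁿ(a)` appear, `subshift τ` is the smallest. -/
theorem isLeast_subshift [Finite A] [TopologicalSpace A] [DiscreteTopology A]
    {τ : A → List A} {p : ℕ} (hp : 2 ≤ p) (hlen : HasConstLength τ p) (hprim : IsPrimitive τ) :
    IsLeast {S : Set (ℤ → A) | IsSubshift S ∧ ∀ n a, AppearsIn (iter τ n a) S} (subshift τ) := by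
  refine ⟨⟨⟨isClosed_subshift τ, Set.ext fun x => fullShift_mem_subshift_iff τ x⟩, ?_⟩, ?_⟩
  · intro n a
    -- points that show `τⁿ(a)` at `0`, and whose window of radius `L` is in the language
    let F : ℕ → Set (ℤ → A) := fun L =>
      {x | factor x 0 (iter τ n a).length = iter τ n a ∧
        ∃ k b, factor x (-(L : ℤ)) (2 * L) <:+: iter τ k b}
    have hclosed : ∀ L, IsClosed (F L) := by
      intro L
      rw [← isOpen_compl_iff, isOpen_iff_mem_nhds]
      intro x hx
      filter_upwards [(isOpen_agree x 0 (iter τ n a).length).mem_nhds (fun j _ => rfl),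
        (isOpen_agree x (-(L : ℤ)) (2 * L)).mem_nhds (fun j _ => rfl)] with y h1 h2 hy
      apply hx
      refine ⟨?_, ?_⟩
      · rw [← factor_congr h1]; exact hy.1
      · rw [← factor_congr h2]; exact hy.2
    have hmono : ∀ L, F (L + 1) ⊆ F L := by
      rintro L x ⟨h, k, b, hk⟩
      refine ⟨h, k, b, List.IsInfix.trans ?_ hk⟩
      have := factor_infix x (-((L + 1 : ℕ) : ℤ)) (2 * (L + 1)) 1 (2 * L) (by omega)
      convert this using 2
      push_cast; ring
    have hne : ∀ L, (F L).Nonempty := by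
      intro L
      obtain ⟨k, b, l, r, hk, hl, hr⟩ := exists_margins hp hlen hprim n a L
      let x : ℤ → A := fun i => ((iter τ k b)[(i + l.length).toNat]?).getD a
      have hx : ∀ (j : ℕ) (h : j < (iter τ k b).length),
          x (-(l.length : ℤ) + j) = (iter τ k b)[j] := by
        intro j h
        have e : (-(l.length : ℤ) + j + l.length).toNat = j := by omega
        simp only [x, e, List.getElem?_eq_getElem h, Option.getD_some]
      have hfac := (factor_eq_iff x _ _).2 hx
      have hlenk : (iter τ k b).length = l.length + (iter τ n a).length + r.length := by
        rw [hk]; simp [add_assoc]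
      refine ⟨x, (factor_eq_iff x _ _).2 ?_, k, b, ?_⟩
      · intro j h
        have h' : l.length + j < (iter τ k b).length := by omega
        have := hx (l.length + j) h'
        rw [show (-(l.length : ℤ) + ((l.length + j : ℕ) : ℤ)) = 0 + j by push_cast; ring] at this
        rw [this]
        simp only [hk]
        rw [List.getElem_append_left (by simp; omega), List.getElem_append_right (by omega)]
        simp
      · conv_rhs => rw [← hfac]
        have := factor_infix x (-(l.length : ℤ)) (iter τ k b).length (l.length - L) (2 * L)
          (by
            have : 0 < p ^ n := Nat.pow_pos (by omega)
            omega)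
        convert this using 2
        push_cast [Nat.cast_sub hl]; ring
    obtain ⟨x, hx⟩ := IsCompact.nonempty_iInter_of_sequence_nonempty_isCompact_isClosed F hmono
      hne (hclosed 0).isCompact hclosed
    rw [Set.mem_iInter] at hx
    refine ⟨x, ?_, 0, (hx 0).1⟩
    intro i m
    obtain ⟨-, k, b, hk⟩ := hx (i.natAbs + m)
    refine ⟨k, b, List.IsInfix.trans ?_ hk⟩
    have := factor_infix x (-((i.natAbs + m : ℕ) : ℤ)) (2 * (i.natAbs + m))
      (i + (i.natAbs + m : ℕ)).toNat m (by omega)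
    convert this using 2
    omega
  · rintro S ⟨⟨hcl, hinv⟩, hS⟩ x hx
    rw [← hcl.closure_eq, mem_closure_iff_nhds]
    intro U hU
    rw [nhds_pi, Filter.mem_pi] at hU
    obtain ⟨I, hI, t, ht, hsub⟩ := hU
    obtain ⟨L, hL⟩ : ∃ L : ℕ, ∀ i ∈ I, i.natAbs < L := by
      obtain ⟨B, hB⟩ := (hI.image Int.natAbs).bddAbove
      exact ⟨B + 1, fun i hi => Nat.lt_succ_of_le (hB ⟨i, hi, rfl⟩)⟩
    obtain ⟨k, a, hk⟩ := hx (-(L : ℤ)) (2 * L)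
    obtain ⟨y, hy, s, hs⟩ := hS k a
    rw [factor_eq_iff] at hs
    obtain ⟨q, hq, hget⟩ := List.infix_iff_getElem?.1 hk
    rw [length_factor] at hq
    refine ⟨fun j => y (j + (s + q + L)), hsub ?_, iterate_preimage hinv y hy _⟩
    intro i hi
    have hiL := hL i hi
    have key : y (i + (s + q + L)) = x i := by
      obtain ⟨j, hj⟩ : ∃ j : ℕ, (j : ℤ) = i + L := ⟨(i + L).toNat, by omega⟩
      have hj2 : j < 2 * L := by omega
      have h1 := hget j (by rw [length_factor]; exact hj2)
      rw [List.getElem?_eq_getElem (by omega), Option.some_inj, getElem_factor] at h1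
      rw [← hs _ (by omega)] at h1
      rw [show i = -(L : ℤ) + j by omega, ← h1]
      congr 1; push_cast; ring
    change y (i + (s + q + L)) ∈ t i
    rw [key]
    exact mem_of_mem_nhds (ht i)

end Subst

/-! The engine is recognizability: when the subshift `X` is infinite, `τ(x)` can be cut into blocks
in only one way (`dvd_of_img_eq`), and a window of bounded length shows the cuts
(`exists_window_dvd_at`). Indeed the translations carrying `τ(X)` into itself form a group `gℤ` with
`g ∣ p`. If `r = p / g` were at least 2, pulling codes back through `τ` would give the shift an `r ^
n`-th root for every `n`, each a block code of radius one (`IsCode.exists_root`). There are finitely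
many such codes, so some positive power of the shift would be the identity and `X` would be finite.

A Li–Yorke pair agrees on arbitrarily long windows to the right and differs arbitrarily far to the
right. By recognizability its two points have the same cuts, so the pair can be desubstituted
forever (`exists_isTower`). Some pair of central letters `(a, b)` occurs at infinitely many levels,
and `a ≠ b`. If the pair is recurrent, a later return of `(a, b)` and a later agreement both fit
into one high-level central block: a double return (`IsTower.doubleReturn`). If there are infinitely
many orbits, two of them share the letters at `0` and `-1` on infinitely many levels. Either their
central positions agree and the orbits are equal, or two different positions supply two returns,
which are nested inside a return with a coincidence to its right
(`IsTower.exists_eq_of_not_doubleReturn`).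

Conversely, let `i < j` be the two return positions and `k` the coincidence. A sequence of digits
`i`, `j`, both infinitely frequent, is the address of a point built from nested blocks of `a`, and
of another built from blocks of `b`. Moving from a digit `i` to `j` at a high level gives a return
of the pair, moving to `k` gives a long agreement, so the pair is strong Li–Yorke. Recognizability
reads the digits back, hence there are uncountably many such pairs
(`exists_injective_of_doubleReturn`). -/

namespace Subst

variable {A : Type*}

/-! ### Translates, images of sequences, and blocks -/

/-- The translate of a two-sided sequence by `k`. -/
def tr (k : ℤ) (x : ℤ → A) : ℤ → A := fun i => x (i + k)

@[simp] lemma tr_apply (k : ℤ) (x : ℤ → A) (i : ℤ) : tr k x i = x (i + k) := rfl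

@[simp] lemma tr_zero (x : ℤ → A) : tr 0 x = x := by funext i; simp

lemma tr_tr (k l : ℤ) (x : ℤ → A) : tr k (tr l x) = tr (k + l) x := by
  funext i; simp [add_assoc]

/-- The image of a two-sided sequence under a substitution of length `p`. -/
def img (τ : A → List A) (p : ℕ) (x : ℤ → A) : ℤ → A :=
  -- For length `p > 0` the index is always in range; the default value is never read.
  fun i => ((τ (x (i / p)))[(i % p).toNat]?).getD (x (i / p))

/-- The word `τⁿ(a)`, indexed by `0 ≤ j < pⁿ`, as the image of a constant sequence. -/
def blk (τ : A → List A) (p n : ℕ) (a : A) : ℤ → A := (img τ p)^[n] fun _ => a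

variable {τ : A → List A} {p : ℕ}

lemma img_congr {x y : ℤ → A} {i : ℤ} (h : x (i / p) = y (i / p)) :
    img τ p x i = img τ p y i := by
  simp only [img, h]

lemma img_tr (hp : 0 < p) (k : ℤ) (x : ℤ → A) : img τ p (tr k x) = tr (p * k) (img τ p x) := by
  funext i
  have h0 : (p : ℤ) ≠ 0 := by omega
  have h : (i + p * k) / p = i / p + k := Int.add_mul_ediv_left _ _ h0
  simp only [img, tr, h, Int.add_mul_emod_self_left]

lemma img_iterate_tr (hp : 0 < p) (n : ℕ) (k : ℤ) (x : ℤ → A) :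
    (img τ p)^[n] (tr k x) = tr (p ^ n * k) ((img τ p)^[n] x) := by
  induction n with
  | zero => simp
  | succ n ih =>
    rw [Function.iterate_succ_apply', ih, img_tr hp, Function.iterate_succ_apply']
    congr 1; ring

lemma img_iterate_congr (n : ℕ) {x y : ℤ → A} {i : ℤ}
    (h : x (i / (p : ℤ) ^ n) = y (i / (p : ℤ) ^ n)) :
    (img τ p)^[n] x i = (img τ p)^[n] y i := by
  induction n generalizing i with
  | zero => simpa using h
  | succ n ih =>
    rw [Function.iterate_succ_apply', Function.iterate_succ_apply']
    apply img_congr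
    apply ih
    rwa [Int.ediv_ediv_of_nonneg (by positivity), ← pow_succ']

lemma img_iterate_eq_blk (hp : 0 < p) (n : ℕ) (x : ℤ → A) {q j : ℤ} (h0 : 0 ≤ j)
    (h1 : j < (p : ℤ) ^ n) : (img τ p)^[n] x (p ^ n * q + j) = blk τ p n (x q) j := by
  have : (img τ p)^[n] x (p ^ n * q + j) = (img τ p)^[n] (tr q x) j := by
    rw [img_iterate_tr hp, tr_apply, add_comm]
  rw [this]
  apply img_iterate_congr
  rw [Int.ediv_eq_zero_of_lt h0 h1]
  simp

lemma blk_add (hp : 0 < p) (m n : ℕ) (a : A) {q j : ℤ} (h0 : 0 ≤ j) (h1 : j < (p : ℤ) ^ n) :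
    blk τ p (m + n) a (p ^ n * q + j) = blk τ p n (blk τ p m a q) j := by
  rw [← img_iterate_eq_blk hp n _ h0 h1, add_comm m n]
  simp only [blk, Function.iterate_add_apply]

/-- A letter is recovered from its own block alone. This local form of injectivity lets agreement on
windows be pulled back through `τ`. -/
lemma eq_of_img_eq (hlen : HasConstLength τ p) (hinj : Function.Injective τ) {x y : ℤ → A} {q : ℤ}
    (h : ∀ j : ℤ, 0 ≤ j → j < p → img τ p x (p * q + j) = img τ p y (p * q + j)) : x q = y q := by
  apply hinj
  apply List.ext_getElem (by rw [hlen, hlen])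
  intro j h1 h2
  have hj : j < p := by rwa [hlen] at h1
  have := h j (by omega) (by omega)
  have e1 : ((p : ℤ) * q + j) / p = q := by
    rw [Int.mul_add_ediv_left _ _ (by omega), Int.ediv_eq_zero_of_lt (by omega) (by omega), add_zero]
  have e2 : ((p : ℤ) * q + j) % p = j := by
    rw [Int.mul_add_emod_self_left, Int.emod_eq_of_lt (by omega) (by omega)]
  simpa only [img, e1, e2, Int.toNat_natCast, List.getElem?_eq_getElem h1,
    List.getElem?_eq_getElem h2, Option.getD_some] using this

lemma img_injective (hlen : HasConstLength τ p) (hinj : Function.Injective τ) :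
    Function.Injective (img τ p) := by
  intro x y h
  funext q
  exact eq_of_img_eq hlen hinj fun j _ _ => by rw [h]

lemma getElem?_onWord (hlen : HasConstLength τ p) (hp : 0 < p) (w : List A) (j : ℕ) :
    (onWord τ w)[j]? = w[j / p]?.bind fun a => (τ a)[j % p]? := by
  induction w generalizing j with
  | nil => simp [onWord]
  | cons a w ih =>
    have e : onWord τ (a :: w) = τ a ++ onWord τ w := by simp [onWord]
    rw [e]
    by_cases h : j < p
    · rw [List.getElem?_append_left (by rw [hlen]; exact h), Nat.div_eq_of_lt h, Nat.mod_eq_of_lt h]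
      simp
    · push Not at h
      rw [List.getElem?_append_right (by rw [hlen]; exact h), hlen, ih,
        Nat.div_eq_sub_div hp h, Nat.mod_eq_sub_mod h]
      simp

lemma length_iter (hlen : HasConstLength τ p) (n : ℕ) (a : A) : (iter τ n a).length = p ^ n := by
  simp [iter, length_onWord_iterate hlen]

lemma getElem?_iter (hlen : HasConstLength τ p) (hp : 0 < p) (n : ℕ) (a : A) {j : ℕ}
    (hj : j < p ^ n) : (iter τ n a)[j]? = some (blk τ p n a j) := by
  induction n generalizing j with
  | zero =>
    have : j = 0 := by simpa using hj
    subst this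
    simp [iter, blk]
  | succ n ih =>
    have h1 : j / p < p ^ n := by
      rw [Nat.div_lt_iff_lt_mul hp]; rwa [pow_succ] at hj
    have e : iter τ (n + 1) a = onWord τ (iter τ n a) := by
      simp only [iter, Function.iterate_succ_apply']
    rw [e, getElem?_onWord hlen hp, ih h1, Option.bind_some]
    have h2 : j % p < (τ (blk τ p n a ↑(j / p))).length := by
      rw [hlen]; exact Nat.mod_lt _ hp
    have e2 : blk τ p (n + 1) a = img τ p (blk τ p n a) := by
      simp only [blk, Function.iterate_succ_apply']
    have e3 : ((j : ℤ) % p).toNat = j % p := by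
      rw [← Int.natCast_mod, Int.toNat_natCast]
    rw [e2]
    simp only [img, ← Int.natCast_div, e3, List.getElem?_eq_getElem h2, Option.getD_some]

lemma getElem_iter (hlen : HasConstLength τ p) (hp : 0 < p) (n : ℕ) (a : A) {j : ℕ}
    (hj : j < (iter τ n a).length) : (iter τ n a)[j] = blk τ p n a j := by
  have h := getElem?_iter hlen hp n a (j := j) (by rwa [length_iter hlen] at hj)
  rw [List.getElem?_eq_getElem hj] at h
  exact Option.some_inj.1 h

lemma mem_subshift_iff (hlen : HasConstLength τ p) (hp : 0 < p) (x : ℤ → A) :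
    x ∈ subshift τ ↔ ∀ l r : ℤ, ∃ (k : ℕ) (a : A) (j : ℤ), 0 ≤ j + l ∧ j + r ≤ (p : ℤ) ^ k ∧
      ∀ s, l ≤ s → s < r → x s = blk τ p k a (j + s) := by
  constructor
  · intro h l r
    obtain ⟨k, a, hk⟩ := h l (r - l).toNat
    obtain ⟨q, hq, hget⟩ := List.infix_iff_getElem?.1 hk
    rw [length_factor, length_iter hlen] at hq
    have hq' : ((r - l).toNat : ℤ) + q ≤ (p : ℤ) ^ k := by exact_mod_cast hq
    refine ⟨k, a, q - l, by omega, by omega, ?_⟩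
    intro s h1 h2
    obtain ⟨t, rfl⟩ : ∃ t : ℕ, s = l + t := ⟨(s - l).toNat, by omega⟩
    have := hget t (by rw [length_factor]; omega)
    rw [getElem_factor, getElem?_iter hlen hp _ _ (by omega), Option.some_inj] at this
    rw [← this]
    congr 1
    push_cast; ring
  · intro h i n
    obtain ⟨k, a, j, h0, h1, hs⟩ := h i (i + n)
    refine ⟨k, a, List.infix_iff_getElem?.2 ⟨(j + i).toNat, ?_, ?_⟩⟩
    · rw [length_factor, length_iter hlen]
      zify
      omega
    · intro t ht
      rw [length_factor] at ht
      rw [getElem_factor, getElem?_iter hlen hp, hs _ (by omega) (by omega)]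
      · congr 2
        push_cast
        omega
      · zify
        omega

lemma tr_mem (hlen : HasConstLength τ p) (hp : 0 < p) {x : ℤ → A} (hx : x ∈ subshift τ) (k : ℤ) :
    tr k x ∈ subshift τ := by
  rw [mem_subshift_iff hlen hp] at hx ⊢
  intro l r
  obtain ⟨n, a, j, h0, h1, hs⟩ := hx (l + k) (r + k)
  refine ⟨n, a, j + k, by omega, by omega, fun s h2 h3 => ?_⟩
  rw [tr_apply, hs _ (by omega) (by omega)]
  congr 1; ring

lemma img_mem (hlen : HasConstLength τ p) (hp : 0 < p) {x : ℤ → A} (hx : x ∈ subshift τ) :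
    img τ p x ∈ subshift τ := by
  rw [mem_subshift_iff hlen hp] at hx ⊢
  intro l r
  have hp' : (0 : ℤ) < p := by omega
  obtain ⟨n, a, j, h0, h1, hs⟩ := hx (l / p) (r / p + 1)
  refine ⟨n + 1, a, p * j, ?_, ?_, fun s h2 h3 => ?_⟩
  · have := Int.mul_ediv_self_le (x := l) hp'.ne'
    nlinarith
  · have := Int.lt_mul_ediv_self_add (x := r) hp'
    rw [pow_succ]
    nlinarith
  · have e : img τ p (tr j (blk τ p n a)) s = blk τ p (n + 1) a (p * j + s) := by
      rw [img_tr hp, tr_apply, add_comm]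
      simp only [blk, Function.iterate_succ_apply']
    rw [← e]
    apply img_congr
    rw [hs (s / p) (Int.ediv_le_ediv hp' h2)
      (by have := Int.ediv_le_ediv hp' h3.le; omega), tr_apply, add_comm]

lemma img_iterate_mem (hlen : HasConstLength τ p) (hp : 0 < p) {x : ℤ → A} (hx : x ∈ subshift τ)
    (n : ℕ) : (img τ p)^[n] x ∈ subshift τ := by
  induction n with
  | zero => exact hx
  | succ n ih => rw [Function.iterate_succ_apply']; exact img_mem hlen hp ih

/-! ### Limits along an ultrafilter -/

lemma exists_eventually_eq {B : Type*} [Finite B] {ι : Type*} (U : Ultrafilter ι) (f : ι → B) :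
    ∃ b, ∀ᶠ n in U, f n = b := by
  have h : ∀ᶠ n in U, ∃ b, f n = b := Eventually.of_forall fun n => ⟨_, rfl⟩
  exact Ultrafilter.eventually_exists_iff.1 h

/-- Compactness of the full shift, without extracting subsequences: several limits along one
ultrafilter can be used together. -/
lemma exists_limit [Finite A] {ι : Type*} (U : Ultrafilter ι) (f : ι → ℤ → A) :
    ∃ x : ℤ → A, ∀ i, ∀ᶠ n in U, f n i = x i := by
  choose x hx using fun i => exists_eventually_eq U fun n => f n i
  exact ⟨x, hx⟩

lemma eventually_window {ι : Type*} {U : Filter ι} {f : ι → ℤ → A} {x : ℤ → A}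
    (h : ∀ i, ∀ᶠ n in U, f n i = x i) (l r : ℤ) :
    ∀ᶠ n in U, ∀ s, l ≤ s → s < r → f n s = x s := by
  have := (Filter.eventually_all_finite (Set.finite_Ico l r)).2 fun s _ => h s
  filter_upwards [this] with n hn s h1 h2 using hn s ⟨h1, h2⟩

lemma limit_mem (hlen : HasConstLength τ p) (hp : 0 < p) {ι : Type*} {U : Filter ι} [U.NeBot]
    {f : ι → ℤ → A} {x : ℤ → A} (h : ∀ i, ∀ᶠ n in U, f n i = x i) (hf : ∀ n, f n ∈ subshift τ) :
    x ∈ subshift τ := by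
  rw [mem_subshift_iff hlen hp]
  intro l r
  obtain ⟨n, hn⟩ := (eventually_window h l r).exists
  obtain ⟨k, a, j, h0, h1, hs⟩ := (mem_subshift_iff hlen hp _).1 (hf n) l r
  exact ⟨k, a, j, h0, h1, fun s h2 h3 => by rw [← hn s h2 h3, hs s h2 h3]⟩

lemma eventually_hyperfilter {P : ℕ → Prop} (h : ∀ᶠ n in atTop, P n) :
    ∀ᶠ n in (hyperfilter ℕ : Filter ℕ), P n :=
  Nat.hyperfilter_le_atTop h

lemma frequently_of_hyperfilter {P : ℕ → Prop} (h : ∀ᶠ n in (hyperfilter ℕ : Filter ℕ), P n) :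
    ∃ᶠ n in atTop, P n := fun h' => by
  obtain ⟨n, h1, h2⟩ := (h.and (eventually_hyperfilter h')).exists
  exact h2 h1

/-! ### Desubstitution and minimality -/

/-- Long central windows of `x` lie in blocks of positive level. The words one level below,
recentred, converge to `y`, while the position modulo `p` stabilizes to `d`. -/
lemma exists_desubst [Finite A] (hlen : HasConstLength τ p) (hp : 2 ≤ p) {x : ℤ → A}
    (hx : x ∈ subshift τ) :
    ∃ (d : ℤ) (y : ℤ → A), 0 ≤ d ∧ d < p ∧ y ∈ subshift τ ∧ x = tr d (img τ p y) := by
  have hp0 : 0 < p := by omega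
  have hp' : (0 : ℤ) < p := by omega
  have hw : ∀ L : ℕ, ∃ (k : ℕ) (a : A) (j : ℤ), L + 1 ≤ j ∧ j + (L + 1) ≤ (p : ℤ) ^ (k + 1) ∧
      ∀ s, -(L : ℤ) ≤ s → s < L → x s = blk τ p (k + 1) a (j + s) := by
    intro L
    obtain ⟨k, a, j, h0, h1, hs⟩ :=
      (mem_subshift_iff hlen hp0 x).1 hx (-((L : ℤ) + 1)) (L + 1)
    -- The window has at least two letters, so it does not fit into a block of level `0`.
    cases k with
    | zero => simp at h1; omega
    | succ k => exact ⟨k, a, j, by omega, by omega, fun s h2 h3 => hs s (by omega) (by omega)⟩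
  choose k a j h0 h1 hs using hw
  obtain ⟨y, hy⟩ := exists_limit (hyperfilter ℕ) fun L => tr (j L / p) (blk τ p (k L) (a L))
  have hfin : ∀ L, 0 ≤ j L % p ∧ j L % p < p := fun L =>
    ⟨Int.emod_nonneg _ (by omega), Int.emod_lt_of_pos _ hp'⟩
  obtain ⟨⟨d, hd0, hd1⟩, hd⟩ := exists_eventually_eq (B := Set.Ico (0 : ℤ) p) (hyperfilter ℕ)
    fun L => ⟨j L % p, hfin L⟩
  refine ⟨d, y, hd0, hd1, ?_, ?_⟩
  · rw [mem_subshift_iff hlen hp0]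
    intro l r
    have hev : ∀ᶠ L : ℕ in atTop, (p : ℤ) * (|l| + |r| + 1) ≤ L :=
      tendsto_natCast_atTop_atTop.eventually_ge_atTop _
    obtain ⟨L, hL, hL2⟩ := ((eventually_window hy l r).and (eventually_hyperfilter hev)).exists
    refine ⟨k L, a L, j L / p, ?_, ?_, fun s h2 h3 => ?_⟩
    · have : |l| ≤ j L / p := by
        rw [Int.le_ediv_iff_mul_le hp']
        have := h0 L
        nlinarith [abs_nonneg r, abs_nonneg l]
      have := neg_abs_le l
      omega
    · have e : j L / p + |r| ≤ (p : ℤ) ^ (k L) := by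
        rw [← Int.add_mul_ediv_right _ _ hp'.ne']
        apply Int.ediv_le_of_le_mul hp'
        rw [← pow_succ]
        have := h1 L
        nlinarith [abs_nonneg r, abs_nonneg l]
      have := le_abs_self r
      omega
    · rw [← hL s h2 h3, tr_apply, add_comm]
  · funext s
    have hev : ∀ᶠ L : ℕ in atTop, |s| + 1 ≤ (L : ℤ) :=
      tendsto_natCast_atTop_atTop.eventually_ge_atTop _
    obtain ⟨L, ⟨hL1, hL2⟩, hL3⟩ := ((hd.and (hy ((s + d) / p))).and
      (eventually_hyperfilter hev)).exists
    have hd' : j L % p = d := congrArg Subtype.val hL1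
    rw [hs L s (by have := neg_abs_le s; omega) (by have := le_abs_self s; omega), tr_apply,
      ← img_congr hL2, img_tr hp0, tr_apply, add_assoc, ← hd', Int.emod_add_mul_ediv, add_comm s]
    simp only [blk, Function.iterate_succ_apply']

lemma exists_desubst_iterate [Finite A] (hlen : HasConstLength τ p) (hp : 2 ≤ p) {x : ℤ → A}
    (hx : x ∈ subshift τ) (n : ℕ) :
    ∃ (d : ℤ) (y : ℤ → A), y ∈ subshift τ ∧ x = tr d ((img τ p)^[n] y) := by
  induction n with
  | zero => exact ⟨0, x, hx, by simp⟩
  | succ n ih =>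
    obtain ⟨d, y, hy, h⟩ := ih
    obtain ⟨e, w, -, -, hw, h'⟩ := exists_desubst hlen hp hy
    refine ⟨d + p ^ n * e, w, hw, ?_⟩
    rw [h, h', img_iterate_tr (by omega), tr_tr, Function.iterate_succ_apply]

/-- Minimality. The window lies in some `τᵏ(a)`; cutting `w` into blocks of level `K + k`,
primitivity puts a copy of `τᵏ(a)` in each of them. -/
lemma exists_window_eq [Finite A] (hlen : HasConstLength τ p) (hp : 2 ≤ p) (hprim : IsPrimitive τ)
    {v w : ℤ → A} (hv : v ∈ subshift τ) (hw : w ∈ subshift τ) (l r : ℤ) :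
    ∃ k : ℤ, ∀ s, l ≤ s → s < r → tr k w s = v s := by
  have hp0 : 0 < p := by omega
  obtain ⟨k, a, j, h0, h1, hs⟩ := (mem_subshift_iff hlen hp0 v).1 hv l r
  obtain ⟨K, hK⟩ := hprim
  obtain ⟨d, y, -, hy⟩ := exists_desubst_iterate hlen hp hw (K + k)
  obtain ⟨q, hq, hqa⟩ := List.mem_iff_getElem.1 (hK a (y 0))
  rw [getElem_iter hlen hp0] at hqa
  rw [length_iter hlen] at hq
  refine ⟨p ^ k * q + j - d, fun s h2 h3 => ?_⟩
  have hb := img_iterate_eq_blk (τ := τ) hp0 (K + k) y (q := 0) (j := p ^ k * q + (j + s))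
    (by have : 0 ≤ j + s := by omega
        positivity)
    (by
      have hq' : (q : ℤ) + 1 ≤ (p : ℤ) ^ K := by exact_mod_cast hq
      have h4 : j + s < (p : ℤ) ^ k := by omega
      have h5 : (0 : ℤ) ≤ (p : ℤ) ^ k := by positivity
      rw [pow_add]
      nlinarith)
  rw [hs s h2 h3, hy, tr_apply, tr_apply, ← hqa, ← blk_add hp0 _ _ _ (by omega) (by omega), ← hb]
  ring_nf

lemma exists_tendsto_translate [Finite A] (hlen : HasConstLength τ p) (hp : 2 ≤ p)
    (hprim : IsPrimitive τ) {v w : ℤ → A} (hv : v ∈ subshift τ) (hw : w ∈ subshift τ) :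
    ∃ k : ℕ → ℤ, ∀ i, ∀ᶠ n in atTop, tr (k n) w i = v i := by
  choose k hk using fun n : ℕ => exists_window_eq hlen hp hprim hv hw (-(n : ℤ)) n
  refine ⟨k, fun i => ?_⟩
  have hev : ∀ᶠ n : ℕ in atTop, |i| + 1 ≤ (n : ℤ) :=
    tendsto_natCast_atTop_atTop.eventually_ge_atTop _
  filter_upwards [hev] with n hn
  exact hk n i (by have := neg_abs_le i; omega) (by have := le_abs_self i; omega)

/-! ### Recognizability -/

/-- The substitution as a self-map of its subshift. -/
def imgMap (hlen : HasConstLength τ p) (hp : 0 < p) (x : subshift τ) : subshift τ :=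
  ⟨img τ p x, img_mem hlen hp x.2⟩

/-- The integers `k` for which the translate by `k` maps `τ(X)` into itself. -/
def imgStab (τ : A → List A) (p : ℕ) : Set ℤ :=
  {k | ∀ v ∈ subshift τ, ∃ u ∈ subshift τ, tr k (img τ p v) = img τ p u}

/-- One relation suffices: by minimality every `v` is a limit of translates of `y`, and the relation
passes to the limit with the same `k`. -/
lemma mem_imgStab_of_eq [Finite A] (hlen : HasConstLength τ p) (hp : 2 ≤ p)
    (hprim : IsPrimitive τ) {x y : ℤ → A} (hx : x ∈ subshift τ) (hy : y ∈ subshift τ) {k : ℤ}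
    (h : tr k (img τ p y) = img τ p x) : k ∈ imgStab τ p := by
  have hp0 : 0 < p := by omega
  intro v hv
  obtain ⟨s, hs⟩ := exists_tendsto_translate hlen hp hprim hv hy
  obtain ⟨u, hu⟩ := exists_limit (hyperfilter ℕ) fun n => tr (s n) x
  refine ⟨u, limit_mem hlen hp0 hu fun n => tr_mem hlen hp0 hx _, ?_⟩
  funext i
  obtain ⟨n, h1, h2⟩ := ((hu (i / p)).and
    (eventually_hyperfilter (hs ((i + k) / p)))).exists
  rw [← img_congr h1, tr_apply, ← img_congr h2, img_tr hp0, img_tr hp0, ← h]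
  simp only [tr_apply]
  congr 1; ring

/-- The additive group of the integers that translate `τ(X)` into itself. -/
def imgStabGroup [Finite A] (hlen : HasConstLength τ p) (hp : 2 ≤ p) (hprim : IsPrimitive τ)
    {x : ℤ → A} (hx : x ∈ subshift τ) : AddSubgroup ℤ where
  carrier := imgStab τ p
  zero_mem' := fun v hv => ⟨v, hv, by simp⟩
  add_mem' := by
    intro k l hk hl v hv
    obtain ⟨u, hu, h⟩ := hl v hv
    obtain ⟨w, hw, h'⟩ := hk u hu
    exact ⟨w, hw, by rw [← tr_tr, h, h']⟩
  neg_mem' := by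
    intro k hk
    obtain ⟨u, hu, h⟩ := hk x hx
    exact mem_imgStab_of_eq hlen hp hprim hx hu (by rw [← h, tr_tr]; simp)

/-- A self-map of the subshift that commutes with the shift and is a block code of radius one. -/
structure IsCode (f : subshift τ → subshift τ) : Prop where
  comm : ∀ (x y : subshift τ) (k : ℤ), (y : ℤ → A) = tr k x → (f y : ℤ → A) = tr k (f x)
  radius : ∀ x y : subshift τ, (∀ i : ℤ, -1 ≤ i → i ≤ 1 → (x : ℤ → A) i = (y : ℤ → A) i) →
    (f x : ℤ → A) 0 = (f y : ℤ → A) 0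

lemma IsCode.congr (hlen : HasConstLength τ p) (hp : 0 < p) {f : subshift τ → subshift τ}
    (hf : IsCode f) {x y : subshift τ} {s : ℤ}
    (h : ∀ i : ℤ, s - 1 ≤ i → i ≤ s + 1 → (x : ℤ → A) i = (y : ℤ → A) i) :
    (f x : ℤ → A) s = (f y : ℤ → A) s := by
  have hx := hf.comm x ⟨tr s x, tr_mem hlen hp x.2 s⟩ s rfl
  have hy := hf.comm y ⟨tr s y, tr_mem hlen hp y.2 s⟩ s rfl
  have := hf.radius ⟨tr s x, tr_mem hlen hp x.2 s⟩ ⟨tr s y, tr_mem hlen hp y.2 s⟩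
    fun i h1 h2 => h _ (by omega) (by omega)
  rw [hx, hy] at this
  simpa using this

lemma IsCode.iterate_congr (hlen : HasConstLength τ p) (hp : 0 < p) {f : subshift τ → subshift τ}
    (hf : IsCode f) (n : ℕ) {x y : subshift τ} {l r : ℤ}
    (h : ∀ i : ℤ, l - n ≤ i → i ≤ r + n → (x : ℤ → A) i = (y : ℤ → A) i) :
    ∀ s : ℤ, l ≤ s → s ≤ r → (f^[n] x : ℤ → A) s = (f^[n] y : ℤ → A) s := by
  induction n generalizing l r with
  | zero => intro s h1 h2; exact h s (by simpa using h1) (by simpa using h2)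
  | succ n ih =>
    intro s h1 h2
    rw [Function.iterate_succ_apply', Function.iterate_succ_apply']
    apply hf.congr hlen hp
    intro i h3 h4
    refine ih (l := l - 1) (r := r + 1) (fun j h5 h6 => h j ?_ ?_) i (by omega) (by omega)
    · push_cast; omega
    · push_cast; omega

lemma IsCode.iterate_comm {f : subshift τ → subshift τ} (hf : IsCode f) (n : ℕ)
    {x y : subshift τ} {k : ℤ} (h : (y : ℤ → A) = tr k x) :
    (f^[n] y : ℤ → A) = tr k (f^[n] x : subshift τ) := by
  induction n generalizing x y with
  | zero => exact h
  | succ n ih =>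
    rw [Function.iterate_succ_apply, Function.iterate_succ_apply]
    exact ih (hf.comm x y k h)

/-- Desubstituting a single value of `f` on the image of `τ` gives `j`; minimality and the finite
radius of `f` spread the same `j` to all points. -/
lemma IsCode.exists_img [Finite A] (hlen : HasConstLength τ p) (hp : 2 ≤ p)
    (hprim : IsPrimitive τ) {f : subshift τ → subshift τ} (hf : IsCode f) (x₀ : subshift τ) :
    ∃ j : ℤ, ∀ v : subshift τ, ∃ u : subshift τ,
      (f (imgMap hlen (by omega) v) : ℤ → A) = tr j (img τ p u) := by
  have hp0 : 0 < p := by omega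
  obtain ⟨j, u₀, -, -, hu₀, h₀⟩ := exists_desubst hlen hp (f (imgMap hlen hp0 x₀)).2
  refine ⟨j, fun v => ?_⟩
  obtain ⟨s, hs⟩ := exists_tendsto_translate hlen hp hprim v.2 x₀.2
  obtain ⟨u, hu⟩ := exists_limit (hyperfilter ℕ) fun n => tr (s n) u₀
  refine ⟨⟨u, limit_mem hlen hp0 hu fun n => tr_mem hlen hp0 hu₀ _⟩, ?_⟩
  funext i
  have hev := eventually_window hs ((i - 1) / p) ((i + 1) / p + 1)
  obtain ⟨n, h1, h2⟩ := ((hu ((i + j) / p)).and (eventually_hyperfilter hev)).exists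
  have e : (f (imgMap hlen hp0 v) : ℤ → A) i =
      (f (imgMap hlen hp0 ⟨tr (s n) x₀, tr_mem hlen hp0 x₀.2 _⟩) : ℤ → A) i := by
    apply hf.congr hlen hp0
    intro t h3 h4
    refine img_congr (h2 (t / p) ?_ ?_).symm
    · exact Int.ediv_le_ediv (by omega) h3
    · have : t / p ≤ (i + 1) / p := Int.ediv_le_ediv (by omega) h4
      omega
  rw [e, hf.comm (imgMap hlen hp0 x₀) _ (p * s n) (img_tr hp0 _ _), h₀, tr_apply, tr_apply, tr_apply,
    ← img_congr h1, img_tr hp0]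
  simp only [tr_apply]
  congr 1; ring

lemma IsCode.exists_img_iterate [Finite A] (hlen : HasConstLength τ p) (hp : 2 ≤ p)
    (hprim : IsPrimitive τ) {f : subshift τ → subshift τ} (hf : IsCode f) (x₀ : subshift τ) :
    ∃ j : ℤ, ∀ (n : ℕ) (v : subshift τ), ∃ u : subshift τ,
      (f^[n] (imgMap hlen (by omega) v) : ℤ → A) = tr (n * j) (img τ p u) := by
  have hp0 : 0 < p := by omega
  obtain ⟨j, hj⟩ := hf.exists_img hlen hp hprim x₀
  refine ⟨j, fun n => ?_⟩
  induction n with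
  | zero => intro v; exact ⟨v, by simp [imgMap]⟩
  | succ n ih =>
    intro v
    obtain ⟨u, hu⟩ := ih v
    obtain ⟨w, hw⟩ := hj u
    refine ⟨w, ?_⟩
    rw [Function.iterate_succ_apply', hf.comm (imgMap hlen hp0 u) _ _ hu, hw, tr_tr]
    congr 1; push_cast; ring

lemma shift_apply (x : subshift τ) : (shift τ x : ℤ → A) = tr 1 x := rfl

lemma shift_iterate (n : ℕ) (x : subshift τ) : ((shift τ)^[n] x : ℤ → A) = tr n x := by
  induction n with
  | zero => simp
  | succ n ih =>
    rw [Function.iterate_succ_apply', shift_apply, ih, tr_tr]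
    congr 1; push_cast; ring

lemma isCode_shift : IsCode (shift τ) where
  comm x y k h := by rw [shift_apply, shift_apply, h, tr_tr, tr_tr, add_comm]
  radius x y h := by
    rw [shift_apply, shift_apply]
    exact h _ (by norm_num) (by norm_num)

lemma IsCode.eq_of_forall (hlen : HasConstLength τ p) (hp : 0 < p) {f g : subshift τ → subshift τ}
    (hf : IsCode f) (hg : IsCode g) (h : ∀ x, (f x : ℤ → A) 0 = (g x : ℤ → A) 0) : f = g := by
  funext x
  apply Subtype.ext
  funext i
  have h1 := hf.comm x ⟨tr i x, tr_mem hlen hp x.2 i⟩ i rfl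
  have h2 := hg.comm x ⟨tr i x, tr_mem hlen hp x.2 i⟩ i rfl
  have := h ⟨tr i x, tr_mem hlen hp x.2 i⟩
  rw [h1, h2] at this
  simpa using this

/-- There are only finitely many block codes of radius one. -/
lemma exists_code_eq [Finite A] (hlen : HasConstLength τ p) (hp : 0 < p)
    {Q : ℕ → subshift τ → subshift τ} (hQ : ∀ n, IsCode (Q n)) : ∃ m n, m < n ∧ Q m = Q n := by
  -- The graph of the local rule, a subset of a finite set, determines the code.
  let F : ℕ → Set (A × A × A × A) := fun n =>
    {t | ∃ x : subshift τ, t = ((x : ℤ → A) (-1), (x : ℤ → A) 0, (x : ℤ → A) 1, (Q n x : ℤ → A) 0)}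
  have key : ∀ m n, F m = F n → Q m = Q n := by
    intro m n h
    refine (hQ m).eq_of_forall hlen hp (hQ n) fun x => ?_
    have hx : ((x : ℤ → A) (-1), (x : ℤ → A) 0, (x : ℤ → A) 1, (Q m x : ℤ → A) 0) ∈ F n := by
      rw [← h]; exact ⟨x, rfl⟩
    obtain ⟨y, hy⟩ := hx
    simp only [Prod.mk.injEq] at hy
    rw [hy.2.2.2]
    apply (hQ n).radius
    intro i h1 h2
    obtain rfl | rfl | rfl : i = -1 ∨ i = 0 ∨ i = 1 := by omega
    · exact hy.1.symm
    · exact hy.2.1.symm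
    · exact hy.2.2.1.symm
  obtain ⟨m, n, hne, h⟩ := Finite.exists_ne_map_eq_of_infinite F
  rcases lt_or_gt_of_ne hne with hlt | hlt
  · exact ⟨m, n, hlt, key _ _ h⟩
  · exact ⟨n, m, hlt, key _ _ h.symm⟩

/-- The map `f^[g]` sends `τ(X)` into a translate of `τ(X)` by a multiple of `g`, hence into `τ(X)`
itself, so `τ ∘ h = f^[g] ∘ τ` defines `h`. Then `τ ∘ h^[r ^ (n + 1)] = f^[r ^ n * p] ∘ τ`, which is
the shift by `p` after `τ`, that is, `τ` after the shift. -/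
lemma IsCode.exists_root [Finite A] (hlen : HasConstLength τ p) (hp : 2 ≤ p)
    (hprim : IsPrimitive τ) (hinj : Function.Injective τ) (x₀ : subshift τ) {g r : ℕ}
    (hgr : g * r = p) (hg : (g : ℤ) ∈ imgStab τ p) {f : subshift τ → subshift τ} (hf : IsCode f)
    {n : ℕ} (hn : f^[r ^ n] = shift τ) :
    ∃ h : subshift τ → subshift τ, IsCode h ∧ h^[r ^ (n + 1)] = shift τ := by
  have hp0 : 0 < p := by omega
  have hr : 0 < r := Nat.pos_of_ne_zero fun h => by subst h; omega
  have hgp : g ≤ p := by nlinarith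
  obtain ⟨j, hj⟩ := hf.exists_img_iterate hlen hp hprim x₀
  have hmem : (g : ℤ) * j ∈ imgStab τ p := by
    have := (imgStabGroup hlen hp hprim x₀.2).zsmul_mem hg j
    rwa [smul_eq_mul, mul_comm] at this
  have hex : ∀ v : subshift τ, ∃ u : subshift τ,
      imgMap hlen hp0 u = f^[g] (imgMap hlen hp0 v) := by
    intro v
    obtain ⟨u, hu⟩ := hj g v
    obtain ⟨w, hw, h⟩ := hmem u u.2
    exact ⟨⟨w, hw⟩, Subtype.ext (by rw [hu, h]; rfl)⟩
  choose h hh using hex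
  have hI : Function.Injective (imgMap hlen hp0 : subshift τ → subshift τ) := fun x y e =>
    Subtype.ext (img_injective hlen hinj (congrArg Subtype.val e))
  refine ⟨h, ⟨?_, ?_⟩, ?_⟩
  · intro x y k e
    apply img_injective hlen hinj
    have e1 : (imgMap hlen hp0 y : ℤ → A) = tr (p * k) (imgMap hlen hp0 x) := by
      change img τ p y = tr (p * k) (img τ p x)
      rw [e, img_tr hp0]
    rw [img_tr hp0]
    change (imgMap hlen hp0 (h y) : ℤ → A) = tr (p * k) (imgMap hlen hp0 (h x))
    rw [hh, hh]
    exact hf.iterate_comm g e1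
  · intro x y e
    apply eq_of_img_eq hlen hinj
    intro i h1 h2
    change (imgMap hlen hp0 (h x) : ℤ → A) _ = (imgMap hlen hp0 (h y) : ℤ → A) _
    rw [hh, hh]
    -- The block at `0` of `f^[g]` depends on coordinates from `-g` to `p - 1 + g`. Since `g ≤ p`,
    -- they lie in the blocks of the letters at `-1`, `0`, `1`, so the radius stays one.
    refine hf.iterate_congr hlen hp0 g (l := 0) (r := p - 1) ?_ _ (by omega) (by omega)
    intro s h3 h4
    refine img_congr (e _ ?_ ?_)
    · rw [Int.le_ediv_iff_mul_le (by omega)]; omega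
    · have : s / p < 2 := by rw [Int.ediv_lt_iff_lt_mul (by omega)]; omega
      omega
  · have hs : Function.Semiconj (imgMap hlen hp0) h f^[g] := hh
    funext x
    apply hI
    have e : g * r ^ (n + 1) = r ^ n * p := by rw [← hgr]; ring
    rw [hs.iterate_right _ x, ← Function.iterate_mul, e, Function.iterate_mul, hn]
    apply Subtype.ext
    rw [shift_iterate]
    change tr p (img τ p x) = img τ p (tr 1 x)
    rw [img_tr hp0, mul_one]

lemma finite_of_periodic [Finite A] {M : ℕ} (hM : 0 < M)
    (h : ∀ x ∈ subshift τ, ∀ i, x (i + M) = x i) : (subshift τ).Finite := by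
  have hinj : Function.Injective fun (x : subshift τ) (i : Fin M) => (x : ℤ → A) (i : ℕ) := by
    intro x y e
    apply Subtype.ext
    funext i
    have key : ∀ z : subshift τ, (z : ℤ → A) i = (z : ℤ → A) ((i % M).toNat : ℤ) := by
      intro z
      have hz : Function.Periodic (z : ℤ → A) M := h z z.2
      have := hz.int_mul (i / M) (i % M)
      rw [Int.cast_id, mul_comm, Int.emod_add_mul_ediv] at this
      rw [this, Int.toNat_of_nonneg (Int.emod_nonneg _ (by omega))]
    rw [key x, key y]
    have hlt : (i % M).toNat < M := by
      have := Int.emod_lt_of_pos i (b := M) (by omega)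
      omega
    exact congrFun e ⟨_, hlt⟩
  have := Finite.of_injective _ hinj
  exact Set.toFinite _

/-- Recognizability: images of points of the subshift have a unique cutting. -/
theorem dvd_of_img_eq [Finite A] (hlen : HasConstLength τ p) (hp : 2 ≤ p) (hprim : IsPrimitive τ)
    (hinj : Function.Injective τ) (hinf : (subshift τ).Infinite) {x y : ℤ → A}
    (hx : x ∈ subshift τ) (hy : y ∈ subshift τ) {k : ℤ}
    (h : tr k (img τ p y) = img τ p x) : (p : ℤ) ∣ k := by
  have hp0 : 0 < p := by omega
  by_contra hk
  have hkG : k ∈ imgStabGroup hlen hp hprim hx := mem_imgStab_of_eq hlen hp hprim hx hy h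
  have hpG : (p : ℤ) ∈ imgStabGroup hlen hp hprim hx := fun v hv =>
    ⟨tr 1 v, tr_mem hlen hp0 hv 1, by rw [img_tr hp0, mul_one]⟩
  obtain ⟨a, ha⟩ := Int.subgroup_cyclic (imgStabGroup hlen hp hprim hx)
  have hmem : ∀ b, b ∈ imgStabGroup hlen hp hprim hx ↔ a ∣ b := by
    intro b
    rw [ha, AddSubgroup.mem_closure_singleton]
    simp only [smul_eq_mul]
    exact ⟨fun ⟨n, hn⟩ => ⟨n, by rw [← hn, mul_comm]⟩, fun ⟨n, hn⟩ => ⟨n, by rw [hn, mul_comm]⟩⟩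
  have hg : (a.natAbs : ℤ) ∈ imgStab τ p := (hmem _).2 (Int.dvd_natAbs.2 dvd_rfl)
  obtain ⟨r, hr⟩ : a.natAbs ∣ p := Int.natAbs_dvd_natAbs.2 ((hmem _).1 hpG)
  -- If `r = 1`, the stabilizer is `pℤ` and `p` divides `k` after all.
  have hr2 : 2 ≤ r := by
    by_contra hlt
    obtain rfl | rfl : r = 0 ∨ r = 1 := by omega
    · omega
    · apply hk
      rw [hr, mul_one, Int.natAbs_dvd]
      exact (hmem k).1 hkG
  have hQ : ∀ n, ∃ f : subshift τ → subshift τ, IsCode f ∧ f^[r ^ n] = shift τ := by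
    intro n
    induction n with
    | zero => exact ⟨shift τ, isCode_shift, by simp⟩
    | succ n ih =>
      obtain ⟨f, hf, hn⟩ := ih
      exact hf.exists_root hlen hp hprim hinj ⟨x, hx⟩ hr.symm hg hn
  choose Q hQ1 hQ2 using hQ
  -- One code is both an `r ^ m`-th and an `r ^ n`-th root of the shift, so the shift equals its own
  -- `r ^ (n - m)`-th power and every point has period `r ^ (n - m) - 1`.
  obtain ⟨m, n, hmn, e⟩ := exists_code_eq hlen hp0 hQ1
  have hT : (shift τ)^[r ^ (n - m)] = shift τ := by
    have : r ^ n = r ^ m * r ^ (n - m) := by rw [← pow_add]; congr 1; omega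
    have h2 := hQ2 n
    rw [← e, this, Function.iterate_mul, hQ2 m] at h2
    exact h2
  have hR : 2 ≤ r ^ (n - m) := le_trans hr2 (Nat.le_self_pow (by omega) r)
  refine hinf (finite_of_periodic (M := r ^ (n - m) - 1) (by omega) fun z hz i => ?_)
  have h3 := congrArg Subtype.val (congrFun hT ⟨z, hz⟩)
  rw [shift_iterate, shift_apply] at h3
  have h4 := congrFun h3 (i - 1)
  simp only [tr_apply, sub_add_cancel] at h4
  rw [← h4]
  congr 1
  push_cast [Nat.cast_sub (show 1 ≤ r ^ (n - m) by omega)]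
  ring

lemma img_iterate_eq_tr [Finite A] (hlen : HasConstLength τ p) (hp : 2 ≤ p) (hprim : IsPrimitive τ)
    (hinj : Function.Injective τ) (hinf : (subshift τ).Infinite) (n : ℕ) {x y : ℤ → A}
    (hx : x ∈ subshift τ) (hy : y ∈ subshift τ) {k : ℤ}
    (h : tr k ((img τ p)^[n] y) = (img τ p)^[n] x) : ∃ q, k = p ^ n * q ∧ tr q y = x := by
  induction n generalizing k with
  | zero => exact ⟨k, by simp, h⟩
  | succ n ih =>
    have hp0 : 0 < p := by omega
    rw [Function.iterate_succ_apply', Function.iterate_succ_apply'] at h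
    obtain ⟨q, rfl⟩ := dvd_of_img_eq hlen hp hprim hinj hinf (img_iterate_mem hlen hp0 hx n)
      (img_iterate_mem hlen hp0 hy n) h
    rw [← img_tr hp0] at h
    obtain ⟨q', rfl, h'⟩ := ih (img_injective hlen hinj h)
    exact ⟨q', by ring, h'⟩

/-- Recognizability from a window of bounded length. -/
theorem exists_window_dvd [Finite A] (hlen : HasConstLength τ p) (hp : 2 ≤ p)
    (hprim : IsPrimitive τ) (hinj : Function.Injective τ) (hinf : (subshift τ).Infinite) :
    ∃ L : ℕ, ∀ x ∈ subshift τ, ∀ y ∈ subshift τ, ∀ k : ℤ,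
      (∀ i, -(L : ℤ) ≤ i → i < L → tr k (img τ p y) i = img τ p x i) → (p : ℤ) ∣ k := by
  have hp0 : 0 < p := by omega
  by_contra hcon
  push Not at hcon
  choose x hx y hy k hk hd using hcon
  obtain ⟨u, hu⟩ := exists_limit (hyperfilter ℕ) x
  -- The shifts `k n` may be unbounded; moving their quotient by `p` into `y n` leaves only the
  -- remainder, which is eventually constant.
  obtain ⟨v, hv⟩ := exists_limit (hyperfilter ℕ) fun n => tr (k n / p) (y n)
  obtain ⟨⟨e, he0, he1⟩, he⟩ := exists_eventually_eq (B := Set.Ico (0 : ℤ) p) (hyperfilter ℕ)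
    fun n => ⟨k n % p, Int.emod_nonneg _ (by omega), Int.emod_lt_of_pos _ (by omega)⟩
  have huv : tr e (img τ p v) = img τ p u := by
    funext i
    have hev : ∀ᶠ n : ℕ in atTop, |i| + 1 ≤ (n : ℤ) :=
      tendsto_natCast_atTop_atTop.eventually_ge_atTop _
    obtain ⟨n, ⟨⟨h1, h2⟩, h3⟩, h4⟩ := (((hu (i / p)).and (hv ((i + e) / p))).and he).and
      (eventually_hyperfilter hev) |>.exists
    have h3' : k n % p = e := congrArg Subtype.val h3
    rw [← img_congr h1, tr_apply, ← img_congr h2, ← hk n i (by have := neg_abs_le i; omega)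
      (by have := le_abs_self i; omega), img_tr hp0, tr_apply, tr_apply, add_assoc, ← h3',
      Int.emod_add_mul_ediv]
  have hdvd := dvd_of_img_eq hlen hp hprim hinj hinf (limit_mem hlen hp0 hu hx)
    (limit_mem hlen hp0 hv fun n => tr_mem hlen hp0 (hy n) _) huv
  obtain ⟨n, h3⟩ := he.exists
  have h3' : k n % p = e := congrArg Subtype.val h3
  apply hd n
  rw [Int.dvd_iff_emod_eq_zero, h3']
  exact Int.eq_zero_of_dvd_of_nonneg_of_lt he0 he1 hdvd

/-- The extra `p` in the length leaves room to recentre the window at a multiple of `p`, where the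
centred version applies. -/
lemma exists_window_dvd_at [Finite A] (hlen : HasConstLength τ p) (hp : 2 ≤ p)
    (hprim : IsPrimitive τ) (hinj : Function.Injective τ) (hinf : (subshift τ).Infinite) :
    ∃ L : ℕ, ∀ x ∈ subshift τ, ∀ y ∈ subshift τ, ∀ k c : ℤ,
      (∀ i, c ≤ i → i < c + L → img τ p y (i + k) = img τ p x i) → (p : ℤ) ∣ k := by
  have hp0 : 0 < p := by omega
  obtain ⟨L, hL⟩ := exists_window_dvd hlen hp hprim hinj hinf
  refine ⟨2 * L + p, fun x hx y hy k c h => ?_⟩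
  obtain ⟨q, hq1, hq2⟩ : ∃ q : ℤ, c + L ≤ p * q ∧ p * q < c + L + p := by
    refine ⟨(c + L + (p - 1)) / p, ?_, ?_⟩
    · have := Int.lt_mul_ediv_self_add (x := c + L + (p - 1)) (k := p) (by omega)
      linarith
    · have := Int.mul_ediv_self_le (x := c + L + (p - 1)) (k := p) (by omega)
      linarith
  refine hL (tr q x) (tr_mem hlen hp0 hx q) (tr q y) (tr_mem hlen hp0 hy q) k fun i h1 h2 => ?_
  rw [img_tr hp0, img_tr hp0]
  simp only [tr_apply]
  rw [← h _ (by omega) (by push_cast; omega)]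
  congr 1; ring

/-! ### Pairs of sequences -/

/-- The two sequences agree on arbitrarily long windows arbitrarily far to the right. -/
def Proximal (x y : ℤ → A) : Prop :=
  ∀ L N : ℕ, ∃ s : ℤ, N ≤ s ∧ ∀ i : ℤ, 0 ≤ i → i < L → x (s + i) = y (s + i)

/-- The two sequences differ arbitrarily far to the right. -/
def NotAsymptotic (x y : ℤ → A) : Prop := ∀ N : ℕ, ∃ s : ℤ, N ≤ s ∧ x s ≠ y s

/-- Each central window of the pair recurs arbitrarily far to the right. -/
def RecurrentPair (x y : ℤ → A) : Prop :=
  ∀ L N : ℕ, ∃ s : ℤ, N ≤ s ∧ ∀ i : ℤ, -L ≤ i → i ≤ L → x (s + i) = x i ∧ y (s + i) = y i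

lemma Proximal.tr_one {x y : ℤ → A} (h : Proximal x y) : Proximal (tr 1 x) (tr 1 y) := by
  intro L N
  obtain ⟨s, hs, h⟩ := h L (N + 1)
  push_cast at hs
  refine ⟨s - 1, by omega, fun i h1 h2 => ?_⟩
  rw [tr_apply, tr_apply, show s - 1 + i + 1 = s + i by ring]
  exact h i h1 h2

lemma NotAsymptotic.tr_one {x y : ℤ → A} (h : NotAsymptotic x y) :
    NotAsymptotic (tr 1 x) (tr 1 y) := by
  intro N
  obtain ⟨s, hs, h⟩ := h (N + 1)
  push_cast at hs
  exact ⟨s - 1, by omega, by simpa using h⟩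

lemma RecurrentPair.tr_one {x y : ℤ → A} (h : RecurrentPair x y) :
    RecurrentPair (tr 1 x) (tr 1 y) := by
  intro L N
  obtain ⟨s, hs, h⟩ := h (L + 1) N
  refine ⟨s, hs, fun i h1 h2 => ?_⟩
  simp only [tr_apply, add_assoc]
  exact h (i + 1) (by push_cast; omega) (by push_cast; omega)

lemma Proximal.desubst (hlen : HasConstLength τ p) (hp : 0 < p) (hinj : Function.Injective τ)
    {x y : ℤ → A} {d : ℤ} (hd : 0 ≤ d)
    (h : Proximal (tr d (img τ p x)) (tr d (img τ p y))) : Proximal x y := by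
  intro L N
  obtain ⟨s, hs, h⟩ := h (p * (L + 1)) (p * N)
  push_cast at hs h
  have hp' : (0 : ℤ) < p := by omega
  have h1 := Int.lt_mul_ediv_self_add (x := s + d) hp'
  have h2 := Int.mul_ediv_self_le (x := s + d) hp'.ne'
  -- The `+ 1` skips the block that the window may only partly contain.
  refine ⟨(s + d) / p + 1, ?_, fun t h3 h4 => ?_⟩
  · have : (N : ℤ) ≤ (s + d) / p := by
      rw [Int.le_ediv_iff_mul_le hp']; nlinarith
    omega
  · apply eq_of_img_eq hlen hinj
    intro j h5 h6
    have := h (p * ((s + d) / p + 1 + t) + j - d - s) (by nlinarith) (by nlinarith)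
    simp only [tr_apply] at this
    convert this using 2 <;> ring

lemma NotAsymptotic.desubst (hp : 0 < p) {x y : ℤ → A} {d : ℤ} (hd : 0 ≤ d)
    (h : NotAsymptotic (tr d (img τ p x)) (tr d (img τ p y))) : NotAsymptotic x y := by
  intro N
  obtain ⟨s, hs, h⟩ := h (p * N)
  push_cast at hs
  refine ⟨(s + d) / p, ?_, fun e => h (img_congr e)⟩
  rw [Int.le_ediv_iff_mul_le (by omega)]
  nlinarith

/-- A return of a window longer than the recognizability length occurs at a multiple of `p`, hence
is a return one level below. -/
lemma RecurrentPair.desubst [Finite A] (hlen : HasConstLength τ p) (hp : 2 ≤ p)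
    (hprim : IsPrimitive τ) (hinj : Function.Injective τ) (hinf : (subshift τ).Infinite)
    {x y : ℤ → A} {d : ℤ} (hx : x ∈ subshift τ) (hd : 0 ≤ d) (hdp : d < p)
    (h : RecurrentPair (tr d (img τ p x)) (tr d (img τ p y))) : RecurrentPair x y := by
  intro L N
  obtain ⟨L₀, hL₀⟩ := exists_window_dvd_at hlen hp hprim hinj hinf
  obtain ⟨s, hs, h⟩ := h (L₀ + p * (L + 2)) (p * N)
  push_cast at hs h
  have hpL : (0 : ℤ) ≤ p * L := by positivity
  obtain ⟨q, rfl⟩ : (p : ℤ) ∣ s := by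
    refine hL₀ x hx x hx s 0 fun i h1 h2 => ?_
    have := (h (i - d) (by nlinarith) (by nlinarith)).1
    simp only [tr_apply, sub_add_cancel] at this
    rw [← this]
    congr 1; ring
  refine ⟨q, by nlinarith, fun t h1 h2 => ?_⟩
  have key : ∀ j : ℤ, 0 ≤ j → j < p →
      (img τ p x (p * (q + t) + j) = img τ p x (p * t + j) ∧
        img τ p y (p * (q + t) + j) = img τ p y (p * t + j)) := by
    intro j h3 h4
    have := h (p * t + j - d) (by nlinarith) (by nlinarith)
    simp only [tr_apply, sub_add_cancel] at this
    rw [show (p : ℤ) * q + (p * t + j - d) + d = p * (q + t) + j by ring] at this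
    exact this
  have e : ∀ z : ℤ → A, (∀ j : ℤ, 0 ≤ j → j < p →
      img τ p z (p * (q + t) + j) = img τ p z (p * t + j)) → z (q + t) = z t := by
    intro z hz
    rw [add_comm]
    refine eq_of_img_eq (x := tr q z) (q := t) hlen hinj fun j h3 h4 => ?_
    rw [← hz j h3 h4, img_tr (by omega), tr_apply]
    congr 1; ring
  exact ⟨e x fun j h3 h4 => (key j h3 h4).1, e y fun j h3 h4 => (key j h3 h4).2⟩

/-- Proximal points of the subshift are cut at the same places. -/
lemma Proximal.eq_cut [Finite A] (hlen : HasConstLength τ p) (hp : 2 ≤ p)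
    (hprim : IsPrimitive τ) (hinj : Function.Injective τ) (hinf : (subshift τ).Infinite)
    {x y : ℤ → A} {d e : ℤ} (hx : x ∈ subshift τ) (hy : y ∈ subshift τ) (hd : 0 ≤ d) (hdp : d < p)
    (he : 0 ≤ e) (hep : e < p) (h : Proximal (tr d (img τ p x)) (tr e (img τ p y))) : d = e := by
  obtain ⟨L₀, hL₀⟩ := exists_window_dvd_at hlen hp hprim hinj hinf
  obtain ⟨s, -, h⟩ := h L₀ 0
  have hdvd : (p : ℤ) ∣ e - d := by
    refine hL₀ x hx y hy (e - d) (s + d) fun i h1 h2 => ?_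
    have := h (i - s - d) (by omega) (by omega)
    simp only [tr_apply] at this
    rw [show s + (i - s - d) + d = i by ring] at this
    rw [this]
    congr 1; ring
  have := Int.eq_zero_of_abs_lt_dvd hdvd (by rw [abs_lt]; omega)
  omega

/-! ### Towers of desubstitutions -/

/-- From level `M` on, each pair `(X n, Y n)` is cut into the images of the letters of
`(X (n + 1), Y (n + 1))`, and the central letter stays within bounded distance of each position to
its right. -/
structure IsTower (τ : A → List A) (p M : ℕ) (X Y : ℕ → ℤ → A) (d : ℕ → ℤ) : Prop where
  left_eq : ∀ n, M ≤ n → X n = tr (d n) (img τ p (X (n + 1)))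
  right_eq : ∀ n, M ≤ n → Y n = tr (d n) (img τ p (Y (n + 1)))
  nonneg : ∀ n, M ≤ n → 0 ≤ d n
  lt : ∀ n, M ≤ n → d n < p
  frequently : ∃ᶠ n in atTop, d n ≠ p - 1

/-- The position of the central letter of level `n` in the central block of level `n + m`. -/
def offset (p : ℕ) (d : ℕ → ℤ) (n m : ℕ) : ℤ := ∑ k ∈ Finset.range m, (p : ℤ) ^ k * d (n + k)

lemma offset_succ (d : ℕ → ℤ) (n m : ℕ) :
    offset p d n (m + 1) = offset p d n m + p ^ m * d (n + m) := by
  rw [offset, Finset.sum_range_succ, offset]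

section offset

variable {M : ℕ} {d : ℕ → ℤ}

lemma offset_succ' (d : ℕ → ℤ) (n m : ℕ) :
    offset p d n (m + 1) = d n + p * offset p d (n + 1) m := by
  rw [offset, Finset.sum_range_succ', offset, Finset.mul_sum, add_comm]
  congr 1
  · simp
  · refine Finset.sum_congr rfl fun k _ => ?_
    rw [show n + (k + 1) = n + 1 + k by ring]
    ring

lemma offset_nonneg (h0 : ∀ n, M ≤ n → 0 ≤ d n) {n : ℕ} (hn : M ≤ n) (m : ℕ) :
    0 ≤ offset p d n m :=
  Finset.sum_nonneg fun k _ => mul_nonneg (by positivity) (h0 _ (by omega))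

lemma offset_lt (h1 : ∀ n, M ≤ n → d n < p) {n : ℕ} (hn : M ≤ n) (m : ℕ) :
    offset p d n m < (p : ℤ) ^ m := by
  induction m with
  | zero => simp [offset]
  | succ m ih =>
    rw [offset_succ, pow_succ]
    have h2 := h1 (n + m) (by omega)
    have h3 : (0 : ℤ) ≤ (p : ℤ) ^ m := by positivity
    nlinarith

/-- The distance to the right end of the block never decreases with the level, and grows at every
level whose digit is not the last one. -/
lemma exists_offset_add_lt (hp : 0 < p) (h1 : ∀ n, M ≤ n → d n < p)
    (hf : ∃ᶠ n in atTop, d n ≠ p - 1) {n : ℕ} (hn : M ≤ n) (B : ℕ) :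
    ∃ m₀, ∀ m, m₀ ≤ m → offset p d n m + B < (p : ℤ) ^ m := by
  have step : ∀ m, (p : ℤ) ^ m - offset p d n m ≤ (p : ℤ) ^ (m + 1) - offset p d n (m + 1) := by
    intro m
    rw [offset_succ, pow_succ]
    have h2 := h1 (n + m) (by omega)
    have h3 : (0 : ℤ) ≤ (p : ℤ) ^ m := by positivity
    nlinarith
  have mono : Monotone fun m => (p : ℤ) ^ m - offset p d n m := monotone_nat_of_le_succ step
  induction B with
  | zero => exact ⟨0, fun m _ => by simpa using offset_lt h1 hn m⟩
  | succ B ih =>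
    obtain ⟨m₀, hm₀⟩ := ih
    obtain ⟨k, hk, hne⟩ := hf.forall_exists_of_atTop (n + m₀)
    obtain ⟨m, rfl⟩ : ∃ m, k = n + m := ⟨k - n, by omega⟩
    refine ⟨m + 1, fun m' hm' => ?_⟩
    have h2 := mono hm'
    have h3 := hm₀ m (by omega)
    simp only [offset_succ, pow_succ] at h2
    have h4 := h1 (n + m) (by omega)
    have h5 : d (n + m) + 2 ≤ p := by omega
    have h6 : (0 : ℤ) < (p : ℤ) ^ m := by positivity
    push_cast
    nlinarith

lemma exists_le_offset (hp : 0 < p) (h0 : ∀ n, M ≤ n → 0 ≤ d n)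
    (hf : ∃ᶠ n in atTop, d n ≠ 0) {n : ℕ} (hn : M ≤ n) (B : ℕ) :
    ∃ m₀, ∀ m, m₀ ≤ m → B ≤ offset p d n m := by
  have mono : Monotone fun m => offset p d n m := by
    refine monotone_nat_of_le_succ fun m => ?_
    rw [offset_succ]
    have := h0 (n + m) (by omega)
    have : 0 ≤ (p : ℤ) ^ m * d (n + m) := by positivity
    omega
  induction B with
  | zero => exact ⟨0, fun m _ => by simpa using offset_nonneg h0 hn m⟩
  | succ B ih =>
    obtain ⟨m₀, hm₀⟩ := ih
    obtain ⟨k, hk, hne⟩ := hf.forall_exists_of_atTop (n + m₀)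
    obtain ⟨m, rfl⟩ : ∃ m, k = n + m := ⟨k - n, by omega⟩
    refine ⟨m + 1, fun m' hm' => ?_⟩
    have h2 := mono hm'
    have h3 := hm₀ m (by omega)
    simp only [offset_succ] at h2
    have h4 := h0 (n + m) (by omega)
    have h5 : 0 < d (n + m) := by omega
    have h6 : 0 < (p : ℤ) ^ m * d (n + m) := by positivity
    push_cast
    omega

end offset

namespace IsTower

variable {M : ℕ} {X Y : ℕ → ℤ → A} {d : ℕ → ℤ}

lemma symm (h : IsTower τ p M X Y d) : IsTower τ p M Y X d :=
  ⟨h.right_eq, h.left_eq, h.nonneg, h.lt, h.frequently⟩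

lemma offset_nonneg (h : IsTower τ p M X Y d) {n : ℕ} (hn : M ≤ n) (m : ℕ) :
    0 ≤ offset p d n m :=
  Subst.offset_nonneg h.nonneg hn m

lemma offset_lt (h : IsTower τ p M X Y d) {n : ℕ} (hn : M ≤ n) (m : ℕ) :
    offset p d n m < (p : ℤ) ^ m :=
  Subst.offset_lt h.lt hn m

lemma exists_covers (h : IsTower τ p M X Y d) (hp : 0 < p) {n : ℕ} (hn : M ≤ n) (B : ℕ) :
    ∃ m₀, ∀ m, m₀ ≤ m → offset p d n m + B < (p : ℤ) ^ m :=
  exists_offset_add_lt hp h.lt h.frequently hn B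

lemma eq_tr (h : IsTower τ p M X Y d) (hp : 0 < p) {n : ℕ} (hn : M ≤ n) (m : ℕ) :
    X n = tr (offset p d n m) ((img τ p)^[m] (X (n + m))) := by
  induction m with
  | zero => simp [offset]
  | succ m ih =>
    rw [ih, h.left_eq (n + m) (by omega), img_iterate_tr hp, tr_tr, offset_succ,
      Function.iterate_succ_apply]
    rfl

lemma apply_eq_blk (h : IsTower τ p M X Y d) (hp : 0 < p) {n : ℕ} (hn : M ≤ n) (m : ℕ) {i q : ℤ}
    (h0 : p ^ m * q ≤ i + offset p d n m) (h1 : i + offset p d n m < p ^ m * q + p ^ m) :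
    X n i = blk τ p m (X (n + m) q) (i + offset p d n m - p ^ m * q) := by
  rw [← img_iterate_eq_blk hp m (X (n + m)) (by omega) (by omega)]
  conv_lhs => rw [h.eq_tr hp hn m]
  rw [tr_apply]
  ring_nf

/-- The translation is common to both coordinates, so towers that meet at one level come from one
orbit of pairs. -/
lemma exists_eq_tr (h : IsTower τ p M X Y d) (hp : 0 < p) {x y : ℤ → A} {c : ℤ}
    (hx : x = tr c ((img τ p)^[M] (X M))) (hy : y = tr c ((img τ p)^[M] (Y M))) {n : ℕ}
    (hn : M ≤ n) :
    ∃ c', x = tr c' ((img τ p)^[n] (X n)) ∧ y = tr c' ((img τ p)^[n] (Y n)) := by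
  obtain ⟨m, rfl⟩ := Nat.exists_eq_add_of_le hn
  refine ⟨c + p ^ M * offset p d M m, ?_, ?_⟩
  · rw [hx, h.eq_tr hp le_rfl m, img_iterate_tr hp, tr_tr, Function.iterate_add_apply]
  · rw [hy, h.symm.eq_tr hp le_rfl m, img_iterate_tr hp, tr_tr, Function.iterate_add_apply]

end IsTower

/-- Proximal points have equal cuts, and desubstitution preserves all three properties, so it can be
iterated. -/
theorem exists_isTower [Finite A] (hlen : HasConstLength τ p) (hp : 2 ≤ p)
    (hprim : IsPrimitive τ) (hinj : Function.Injective τ) (hinf : (subshift τ).Infinite)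
    {x y : ℤ → A} (hx : x ∈ subshift τ) (hy : y ∈ subshift τ) (h1 : Proximal x y)
    (h2 : NotAsymptotic x y) :
    ∃ (M : ℕ) (X Y : ℕ → ℤ → A) (d : ℕ → ℤ) (c : ℤ), IsTower τ p M X Y d ∧
      x = tr c ((img τ p)^[M] (X M)) ∧ y = tr c ((img τ p)^[M] (Y M)) ∧
      ∀ n, M ≤ n → Proximal (X n) (Y n) ∧ NotAsymptotic (X n) (Y n) ∧
        (RecurrentPair x y → RecurrentPair (X n) (Y n)) := by
  have hp0 : 0 < p := by omega
  let S := {z : (ℤ → A) × (ℤ → A) // z.1 ∈ subshift τ ∧ z.2 ∈ subshift τ ∧ Proximal z.1 z.2 ∧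
    NotAsymptotic z.1 z.2 ∧ (RecurrentPair x y → RecurrentPair z.1 z.2)}
  have step : ∀ z : S, ∃ (d : ℤ) (w : S), 0 ≤ d ∧ d < p ∧ z.1.1 = tr d (img τ p w.1.1) ∧
      z.1.2 = tr d (img τ p w.1.2) := by
    rintro ⟨⟨u, v⟩, hu, hv, hP, hN, hR⟩
    obtain ⟨d, u', hd0, hd1, hu', rfl⟩ := exists_desubst hlen hp hu
    obtain ⟨e, v', he0, he1, hv', rfl⟩ := exists_desubst hlen hp hv
    obtain rfl := hP.eq_cut hlen hp hprim hinj hinf hu' hv' hd0 hd1 he0 he1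
    exact ⟨d, ⟨⟨u', v'⟩, hu', hv', hP.desubst hlen hp0 hinj hd0, hN.desubst hp0 hd0, fun h =>
      (hR h).desubst hlen hp hprim hinj hinf hu' hd0 hd1⟩, hd0, hd1, rfl, rfl⟩
  choose dig next hd0 hd1 hl hr using step
  let Z : ℕ → S := fun n => next^[n] ⟨⟨x, y⟩, hx, hy, h1, h2, id⟩
  have hZ : ∀ n, Z (n + 1) = next (Z n) := fun n => Function.iterate_succ_apply' _ _ _
  have hZl : ∀ n, (Z n).1.1 = tr (dig (Z n)) (img τ p (Z (n + 1)).1.1) := fun n => by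
    rw [hZ]; exact hl _
  have hZr : ∀ n, (Z n).1.2 = tr (dig (Z n)) (img τ p (Z (n + 1)).1.2) := fun n => by
    rw [hZ]; exact hr _
  by_cases hfreq : ∃ᶠ n in atTop, dig (Z n) ≠ p - 1
  · exact ⟨0, fun n => (Z n).1.1, fun n => (Z n).1.2, fun n => dig (Z n), 0,
      ⟨fun n _ => hZl n, fun n _ => hZr n, fun n _ => hd0 _, fun n _ => hd1 _, hfreq⟩,
      by simp [Z], by simp [Z], fun n _ => (Z n).2.2.2⟩
  · simp only [not_frequently, not_not, eventually_atTop] at hfreq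
    obtain ⟨M, hM⟩ := hfreq
    have hex : ∀ n, ∃ c, x = tr c ((img τ p)^[n] (Z n).1.1) ∧
        y = tr c ((img τ p)^[n] (Z n).1.2) := by
      intro n
      induction n with
      | zero => exact ⟨0, by simp [Z], by simp [Z]⟩
      | succ n ih =>
        obtain ⟨c, hc1, hc2⟩ := ih
        refine ⟨c + p ^ n * dig (Z n), ?_, ?_⟩
        · refine hc1.trans ?_
          conv_lhs => rw [hZl n]
          rw [img_iterate_tr hp0, tr_tr, Function.iterate_succ_apply]
        · refine hc2.trans ?_
          conv_lhs => rw [hZr n]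
          rw [img_iterate_tr hp0, tr_tr, Function.iterate_succ_apply]
    obtain ⟨c, hc1, hc2⟩ := hex M
    -- If all digits from `M` on are `p - 1`, the central blocks never grow to the right. One step
    -- to the right at each level makes the centre the first letter of the next block, with all
    -- digits `0`.
    refine ⟨M, fun n => tr 1 (Z n).1.1, fun n => tr 1 (Z n).1.2, fun _ => 0, c - p ^ M,
      ⟨?_, ?_, fun _ _ => le_rfl, fun _ _ => by omega, ?_⟩, ?_, ?_, fun n _ => ?_⟩
    · intro n hn
      conv_lhs => rw [hZl n]
      rw [hM n hn, img_tr hp0, tr_tr, tr_zero]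
      congr 1; ring
    · intro n hn
      conv_lhs => rw [hZr n]
      rw [hM n hn, img_tr hp0, tr_tr, tr_zero]
      congr 1; ring
    · exact (Eventually.of_forall fun _ => by omega).frequently
    · rw [img_iterate_tr hp0, tr_tr]
      refine hc1.trans ?_
      congr 1; ring
    · rw [img_iterate_tr hp0, tr_tr]
      refine hc2.trans ?_
      congr 1; ring
    · obtain ⟨-, -, hP, hN, hR⟩ := (Z n).2
      exact ⟨hP.tr_one, hN.tr_one, fun h => (hR h).tr_one⟩

/-! ### Double returns -/

lemma eq_append_of_lt {α : Type*} (l : List α) {i j : ℕ} (hij : i < j) (hj : j < l.length) :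
    l = l.take i ++ [l[i]] ++ (l.take j).drop (i + 1) ++ [l[j]] ++ l.drop (j + 1) := by
  have h1 : l.take j = l.take i ++ [l[i]] ++ (l.take j).drop (i + 1) := by
    have hi : i < (l.take j).length := by rw [List.length_take]; omega
    have h2 : (l.take j).take (i + 1) = (l.take j).take i ++ [(l.take j)[i]] :=
      (List.take_append_getElem hi).symm
    rw [List.take_take, List.take_take, min_eq_left (by omega), min_eq_left (by omega),
      List.getElem_take] at h2
    conv_lhs => rw [← List.take_append_drop (i + 1) (l.take j)]
    rw [List.take_take, min_eq_left (by omega), h2]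
  rw [← h1]
  simp

lemma getElem?_append_cons {α : Type*} {l : List α} {c : α} {r : List α} {n : ℕ}
    (hn : n = l.length) : (l ++ c :: r)[n]? = some c := by
  subst hn; simp

/-- The double return condition in terms of positions in the blocks of level `m`. -/
lemma doubleReturn_iff (hlen : HasConstLength τ p) (hp : 0 < p) :
    DoubleReturnCondition τ ↔ ∃ (m : ℕ) (a b : A) (i j k : ℤ), a ≠ b ∧ 0 ≤ i ∧ i < j ∧
      j < (p : ℤ) ^ m ∧ i < k ∧ k < (p : ℤ) ^ m ∧ blk τ p m a i = a ∧ blk τ p m b i = b ∧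
      blk τ p m a j = a ∧ blk τ p m b j = b ∧ blk τ p m a k = blk τ p m b k := by
  constructor
  · rintro ⟨m, a, b, hab, u, v, w, u', v', w', ha, hb, hu, hv, hw, t, ht, ht', hc⟩
    have hla : u.length + 1 + v.length + 1 + w.length = p ^ m := by
      rw [← length_iter hlen m a, ha]; simp; omega
    have hla' : (u.length + 1 + v.length + 1 + w.length : ℤ) = (p : ℤ) ^ m := by exact_mod_cast hla
    have ht₂ := ht
    simp only [List.length_append, List.length_singleton] at ht₂
    have key : ∀ (c e : A) (j : ℕ), (iter τ m c)[j]? = some e → blk τ p m c j = e := by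
      intro c e j h
      obtain ⟨hj, h⟩ := List.getElem?_eq_some_iff.1 h
      rwa [getElem_iter hlen hp] at h
    refine ⟨m, a, b, u.length, (u.length + 1 + v.length : ℕ), (u.length + 1 + t : ℕ), hab,
      by omega, by omega, by omega, by omega, by omega, ?_, ?_, ?_, ?_, ?_⟩
    · apply key; rw [ha]; simp
    · apply key; rw [hb, hu]; simp
    · apply key
      rw [show iter τ m a = (u ++ [a] ++ v) ++ a :: w by rw [ha]; simp]
      exact getElem?_append_cons (by simp; omega)
    · apply key
      rw [show iter τ m b = (u' ++ [b] ++ v') ++ b :: w' by rw [hb]; simp]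
      exact getElem?_append_cons (by simp; omega)
    · have e1 : (iter τ m a)[u.length + 1 + t]? = (v ++ [a] ++ w)[t]? := by
        have : iter τ m a = (u ++ [a]) ++ (v ++ [a] ++ w) := by rw [ha]; simp
        rw [this, List.getElem?_append_right (by simp)]
        simp
      have e2 : (iter τ m b)[u.length + 1 + t]? = (v' ++ [b] ++ w')[t]? := by
        have : iter τ m b = (u' ++ [b]) ++ (v' ++ [b] ++ w') := by rw [hb]; simp
        rw [this, hu, List.getElem?_append_right (by simp)]
        simp
      rw [List.getElem?_eq_getElem ht] at e1
      rw [List.getElem?_eq_getElem ht'] at e2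
      rw [key _ _ _ e1, key _ _ _ e2, hc]
  · rintro ⟨m, a, b, i, j, k, hab, h0, hij, hj, hik, hk, hai, hbi, haj, hbj, hc⟩
    lift i to ℕ using h0
    lift j to ℕ using by omega
    lift k to ℕ using by omega
    have hj' : j < p ^ m := by exact_mod_cast hj
    have hk' : k < p ^ m := by exact_mod_cast hk
    have hij' : i < j := by exact_mod_cast hij
    have hik' : i < k := by exact_mod_cast hik
    have split : ∀ c : A, blk τ p m c i = c → blk τ p m c j = c → iter τ m c =
        (iter τ m c).take i ++ [c] ++ ((iter τ m c).take j).drop (i + 1) ++ [c] ++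
          (iter τ m c).drop (j + 1) := by
      intro c h1 h2
      have := eq_append_of_lt (iter τ m c) hij' (by rwa [length_iter hlen])
      rwa [getElem_iter hlen hp, getElem_iter hlen hp, h1, h2] at this
    have tail : ∀ c : A, blk τ p m c i = c → blk τ p m c j = c →
        ((iter τ m c).take j).drop (i + 1) ++ [c] ++ (iter τ m c).drop (j + 1) =
          (iter τ m c).drop (i + 1) := by
      intro c h1 h2
      conv_rhs => rw [split c h1 h2]
      rw [show ∀ T V W : List A, T ++ [c] ++ V ++ [c] ++ W = (T ++ [c]) ++ (V ++ [c] ++ W) by simp]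
      rw [List.drop_left' (by simp [length_iter hlen]; omega)]
    refine ⟨m, a, b, hab, _, _, _, _, _, _, split a hai haj, split b hbi hbj, ?_, ?_, ?_, ?_⟩
    · simp [length_iter hlen]
    · simp [length_iter hlen]
    · simp [length_iter hlen]
    · rw [tail a hai haj, tail b hbi hbj]
      refine ⟨k - (i + 1), by simp [length_iter hlen]; omega, by simp [length_iter hlen]; omega, ?_⟩
      rw [List.getElem_drop, List.getElem_drop, getElem_iter hlen hp, getElem_iter hlen hp,
        show i + 1 + (k - (i + 1)) = k by omega, hc]

/-- A return with a coincidence to its right, together with two returns, gives a double return. -/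
lemma doubleReturn_of_returns (hlen : HasConstLength τ p) (hp : 0 < p) {m t : ℕ} {a b : A}
    (hab : a ≠ b) {q r s₁ s₂ : ℤ} (hq : 0 ≤ q) (hqr : q < r) (hr : r < (p : ℤ) ^ m)
    (haq : blk τ p m a q = a) (hbq : blk τ p m b q = b) (hc : blk τ p m a r = blk τ p m b r)
    (h0 : 0 ≤ s₁) (h12 : s₁ < s₂) (h2 : s₂ < (p : ℤ) ^ t) (ha₁ : blk τ p t a s₁ = a)
    (hb₁ : blk τ p t b s₁ = b) (ha₂ : blk τ p t a s₂ = a) (hb₂ : blk τ p t b s₂ = b) :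
    DoubleReturnCondition τ := by
  have hpt : (0 : ℤ) < (p : ℤ) ^ t := by positivity
  -- Both returns sit inside the sub-block at `q`; the coincidence is at the left end of the later
  -- sub-block at `r`.
  refine (doubleReturn_iff hlen hp).2 ⟨m + t, a, b, p ^ t * q + s₁, p ^ t * q + s₂, p ^ t * r + 0,
    hab, by positivity, by omega, ?_, ?_, ?_, ?_, ?_, ?_, ?_, ?_⟩
  · rw [pow_add]; nlinarith
  · nlinarith
  · rw [pow_add]; nlinarith
  · rw [blk_add hp _ _ _ h0 (by omega), haq, ha₁]
  · rw [blk_add hp _ _ _ h0 (by omega), hbq, hb₁]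
  · rw [blk_add hp _ _ _ (by omega) h2, haq, ha₂]
  · rw [blk_add hp _ _ _ (by omega) h2, hbq, hb₂]
  · rw [blk_add hp _ _ _ le_rfl hpt, blk_add hp _ _ _ le_rfl hpt, hc]

lemma exists_add_of_frequently {P : ℕ → Prop} (h : ∃ᶠ n in atTop, P n) (N m₀ : ℕ) :
    ∃ m, m₀ ≤ m ∧ P (N + m) := by
  obtain ⟨k, hk, hP⟩ := h.forall_exists_of_atTop (N + m₀)
  exact ⟨k - N, by omega, by rwa [show N + (k - N) = k by omega]⟩

namespace IsTower

variable {M : ℕ} {X Y X' Y' : ℕ → ℤ → A} {d d' : ℕ → ℤ}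

lemma mono (h : IsTower τ p M X Y d) {N : ℕ} (hN : M ≤ N) : IsTower τ p N X Y d :=
  ⟨fun n hn => h.left_eq n (by omega), fun n hn => h.right_eq n (by omega),
    fun n hn => h.nonneg n (by omega), fun n hn => h.lt n (by omega), h.frequently⟩

lemma apply_eq_blk_zero (h : IsTower τ p M X Y d) (hp : 0 < p) {n : ℕ} (hn : M ≤ n) (m : ℕ) {i : ℤ}
    (h0 : 0 ≤ i + offset p d n m) (h1 : i + offset p d n m < p ^ m) :
    X n i = blk τ p m (X (n + m) 0) (i + offset p d n m) := by
  rw [h.apply_eq_blk hp hn m (q := 0) (by simpa using h0) (by simpa using h1)]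
  simp

lemma return_eq (h : IsTower τ p M X Y d) (hp : 0 < p) {n : ℕ} (hn : M ≤ n) (m : ℕ) {a : A}
    (h1 : X n 0 = a) (h2 : X (n + m) 0 = a) : blk τ p m a (offset p d n m) = a := by
  have := h.apply_eq_blk_zero hp hn m (i := 0) (by simpa using h.offset_nonneg hn m)
    (by simpa using h.offset_lt hn m)
  rw [h1, h2, zero_add] at this
  exact this.symm

/-- With `a = b`, equal central blocks would cover each position to the right, and the sequences
would agree there. -/
lemma ne_of_frequently (h : IsTower τ p M X Y d) (hp : 0 < p) (hN : NotAsymptotic (X M) (Y M))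
    {a b : A} (hI : ∃ᶠ n in atTop, X n 0 = a ∧ Y n 0 = b) : a ≠ b := by
  rintro rfl
  obtain ⟨s, hs, hne⟩ := hN 0
  lift s to ℕ using by simpa using hs
  obtain ⟨m₀, hm₀⟩ := h.exists_covers hp le_rfl s
  obtain ⟨m, hm, hX, hY⟩ := exists_add_of_frequently hI M m₀
  have h0 := h.offset_nonneg le_rfl m
  have h1 := hm₀ m hm
  apply hne
  rw [h.apply_eq_blk_zero hp le_rfl m (by omega) (by omega),
    h.symm.apply_eq_blk_zero hp le_rfl m (by omega) (by omega), hX, hY]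

/-- Start at a level `N` with centre `(a, b)`. Recurrence gives a later `(a, b)`, proximality a
later coincidence, and a central block of a higher level with the same centre contains both. -/
lemma doubleReturn (h : IsTower τ p M X Y d) (hlen : HasConstLength τ p) (hp : 0 < p)
    {a b : A} (hab : a ≠ b) (hI : ∃ᶠ n in atTop, X n 0 = a ∧ Y n 0 = b)
    (hP : ∀ n, M ≤ n → Proximal (X n) (Y n)) (hR : ∀ n, M ≤ n → RecurrentPair (X n) (Y n)) :
    DoubleReturnCondition τ := by
  obtain ⟨k, -, hXM, hYM⟩ := exists_add_of_frequently hI M 0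
  have hN : M ≤ M + k := by omega
  generalize M + k = N at hXM hYM hN
  obtain ⟨s, hs, hsr⟩ := hR N hN 0 1
  obtain ⟨t, ht, htc⟩ := hP N hN 1 1
  have hs0 := hsr 0 (by simp) (by simp)
  have ht0 := htc 0 le_rfl (by simp)
  rw [add_zero] at hs0 ht0
  rw [hXM, hYM] at hs0
  lift s to ℕ using by omega
  lift t to ℕ using by omega
  obtain ⟨m₀, hm₀⟩ := h.exists_covers hp hN (s + t)
  obtain ⟨m, hm, hX, hY⟩ := exists_add_of_frequently hI N m₀
  have h0 := h.offset_nonneg hN m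
  have h1 := hm₀ m hm
  push_cast at h1 hs ht
  refine (doubleReturn_iff hlen hp).2 ⟨m, a, b, offset p d N m, s + offset p d N m,
    t + offset p d N m, hab, h0, by omega, by omega, by omega, by omega,
    h.return_eq hp hN m hXM hX, h.symm.return_eq hp hN m hYM hY, ?_, ?_, ?_⟩
  · rw [← hX, ← h.apply_eq_blk_zero hp hN m (by omega) (by omega), hs0.1, hX]
  · rw [← hY, ← h.symm.apply_eq_blk_zero hp hN m (by omega) (by omega), hs0.2, hY]
  · rw [← hX, ← hY, ← h.apply_eq_blk_zero hp hN m (by omega) (by omega),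
      ← h.symm.apply_eq_blk_zero hp hN m (by omega) (by omega), ht0]

/-- Central blocks exhaust the right half-line but may stop growing to the left; the block at `-1`
then covers the rest. -/
lemma eq_of_same_central (h : IsTower τ p M X Y d) (h' : IsTower τ p M X' Y' d') (hp : 0 < p)
    {N : ℕ} (hN : M ≤ N) {P : ℕ → Prop} (hI : ∃ᶠ n in atTop, P n)
    (h0 : ∀ n, P n → X n 0 = X' n 0) (h1 : ∀ n, P n → X n (-1) = X' n (-1))
    (ho : ∀ m, P (N + m) → offset p d N m = offset p d' N m) : X N = X' N := by
  funext i
  obtain ⟨m₀, hm₀⟩ := h.exists_covers hp hN i.natAbs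
  obtain ⟨m, hm, hPm⟩ := exists_add_of_frequently hI N m₀
  have h2 := h.offset_nonneg hN m
  have h3 := hm₀ m hm
  have h4 := ho m hPm
  by_cases hi : 0 ≤ i + offset p d N m
  · rw [h.apply_eq_blk_zero hp hN m hi (by omega),
      h'.apply_eq_blk_zero hp hN m (by omega) (by omega), h0 _ hPm, h4]
  · rw [h.apply_eq_blk hp hN m (q := -1) (by omega) (by omega),
      h'.apply_eq_blk hp hN m (q := -1) (by omega) (by omega), h1 _ hPm, h4]

/-- Each offset between levels with centre `(a, b)` is a return of both letters. Two towers with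
different offsets show two returns in one block, and a coincidence from the first tower completes a
double return; so the offsets agree. -/
lemma exists_eq_of_not_doubleReturn (h : IsTower τ p M X Y d) (h' : IsTower τ p M X' Y' d')
    (hlen : HasConstLength τ p) (hp : 0 < p) (hD : ¬ DoubleReturnCondition τ) {a b : A}
    (hab : a ≠ b) (hP : ∀ n, M ≤ n → Proximal (X n) (Y n))
    (hI : ∃ᶠ n in atTop, (X n 0 = a ∧ Y n 0 = b) ∧ (X' n 0 = a ∧ Y' n 0 = b) ∧
      X n (-1) = X' n (-1) ∧ Y n (-1) = Y' n (-1)) :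
    ∃ N, M ≤ N ∧ X N = X' N ∧ Y N = Y' N := by
  obtain ⟨k, -, ⟨hXN, hYN⟩, ⟨hXN', hYN'⟩, -⟩ := exists_add_of_frequently hI M 0
  have hN : M ≤ M + k := by omega
  generalize M + k = N at hXN hYN hXN' hYN' hN
  obtain ⟨t, ht, htc⟩ := hP N hN 1 1
  have ht0 := htc 0 le_rfl (by simp)
  rw [add_zero] at ht0
  lift t to ℕ using by omega
  obtain ⟨m₀, hm₀⟩ := h.exists_covers hp hN t
  obtain ⟨m₁, hm₁, ⟨hX, hY⟩, -⟩ := exists_add_of_frequently hI N m₀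
  have h0 := h.offset_nonneg hN m₁
  have h1 := hm₀ m₁ hm₁
  have hc : blk τ p m₁ a (t + offset p d N m₁) = blk τ p m₁ b (t + offset p d N m₁) := by
    rw [← hX, ← hY, ← h.apply_eq_blk_zero hp hN m₁ (by omega) (by omega),
      ← h.symm.apply_eq_blk_zero hp hN m₁ (by omega) (by omega), ht0]
  have hret : ∀ {t : ℕ} {s₁ s₂ : ℤ}, 0 ≤ s₁ → s₁ < s₂ → s₂ < (p : ℤ) ^ t → blk τ p t a s₁ = a →
      blk τ p t b s₁ = b → blk τ p t a s₂ = a → blk τ p t b s₂ = b → False :=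
    fun h2 h3 h4 h5 h6 h7 h8 => hD (doubleReturn_of_returns hlen hp hab h0 (by omega) (by omega)
      (h.return_eq hp hN m₁ hXN hX) (h.symm.return_eq hp hN m₁ hYN hY) hc h2 h3 h4 h5 h6 h7 h8)
  have ho : ∀ m, ((X (N + m) 0 = a ∧ Y (N + m) 0 = b) ∧ (X' (N + m) 0 = a ∧ Y' (N + m) 0 = b) ∧
      X (N + m) (-1) = X' (N + m) (-1) ∧ Y (N + m) (-1) = Y' (N + m) (-1)) →
      offset p d N m = offset p d' N m := by
    rintro m ⟨⟨h2, h3⟩, ⟨h4, h5⟩, -⟩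
    have r1 := h.return_eq hp hN m hXN h2
    have r2 := h.symm.return_eq hp hN m hYN h3
    have r3 := h'.return_eq hp hN m hXN' h4
    have r4 := h'.symm.return_eq hp hN m hYN' h5
    rcases lt_trichotomy (offset p d N m) (offset p d' N m) with hlt | heq | hlt
    · exact (hret (h.offset_nonneg hN m) hlt (h'.offset_lt hN m) r1 r2 r3 r4).elim
    · exact heq
    · exact (hret (h'.offset_nonneg hN m) hlt (h.offset_lt hN m) r3 r4 r1 r2).elim
  exact ⟨N, hN, h.eq_of_same_central h' hp hN hI (fun n h => h.1.1.trans h.2.1.1.symm)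
    (fun n h => h.2.2.1) ho, h.symm.eq_of_same_central h'.symm hp hN hI
    (fun n h => h.1.2.trans h.2.1.2.symm) (fun n h => h.2.2.2) ho⟩

end IsTower

theorem doubleReturn_of_recurrentPair [Finite A] (hlen : HasConstLength τ p) (hp : 2 ≤ p)
    (hprim : IsPrimitive τ) (hinj : Function.Injective τ) (hinf : (subshift τ).Infinite)
    {x y : ℤ → A} (hx : x ∈ subshift τ) (hy : y ∈ subshift τ) (h1 : Proximal x y)
    (h2 : NotAsymptotic x y) (h3 : RecurrentPair x y) : DoubleReturnCondition τ := by
  obtain ⟨M, X, Y, d, c, hT, -, -, hXY⟩ := exists_isTower hlen hp hprim hinj hinf hx hy h1 h2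
  obtain ⟨⟨a, b⟩, hab⟩ := exists_eventually_eq (hyperfilter ℕ) fun n => (X n 0, Y n 0)
  have hI := frequently_of_hyperfilter hab
  simp only [Prod.mk.injEq] at hI
  exact hT.doubleReturn hlen (by omega) (hT.ne_of_frequently (by omega) (hXY M le_rfl).2.1 hI) hI
    (fun n hn => (hXY n hn).1) fun n hn => (hXY n hn).2.2 h3

/-- Without double returns, there are finitely many orbits of pairs that are proximal but not
asymptotic. -/
theorem doubleReturn_of_infinite [Finite A] (hlen : HasConstLength τ p) (hp : 2 ≤ p)
    (hprim : IsPrimitive τ) (hinj : Function.Injective τ) (hinf : (subshift τ).Infinite)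
    {ι : Type*} [Infinite ι] {x y : ι → ℤ → A} (hx : ∀ i, x i ∈ subshift τ)
    (hy : ∀ i, y i ∈ subshift τ) (h1 : ∀ i, Proximal (x i) (y i))
    (h2 : ∀ i, NotAsymptotic (x i) (y i))
    (hdis : ∀ i j, ∀ c : ℤ, x i = tr c (x j) → y i = tr c (y j) → i = j) :
    DoubleReturnCondition τ := by
  have hp0 : 0 < p := by omega
  by_contra hD
  choose M X Y d c hT hxc hyc hXY using fun i =>
    exists_isTower hlen hp hprim hinj hinf (hx i) (hy i) (h1 i) (h2 i)
  -- Pigeonhole over the four letters at `0` and `-1`. As a single ultrafilter serves all indices,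
  -- two towers with equal values share them on infinitely many common levels.
  choose f hf using fun i => exists_eventually_eq (hyperfilter ℕ) fun n =>
    ((X i n 0, Y i n 0), X i n (-1), Y i n (-1))
  obtain ⟨i, j, hij, hfij⟩ := Finite.exists_ne_map_eq_of_infinite f
  rcases hfi : f i with ⟨⟨a, b⟩, a', b'⟩ 
  have hI := frequently_of_hyperfilter ((hf i).and (hf j))
  rw [← hfij, hfi] at hI
  simp only [Prod.mk.injEq] at hI
  have hTi := (hT i).mono (le_max_left (M i) (M j))
  have hTj := (hT j).mono (le_max_right (M i) (M j))
  have hab : a ≠ b := (hT i).ne_of_frequently hp0 (hXY i _ le_rfl).2.1 (hI.mono fun n h => h.1.1)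
  obtain ⟨N, hN, hXN, hYN⟩ := hTi.exists_eq_of_not_doubleReturn hTj hlen hp0 hD hab
    (fun n hn => (hXY i n (le_trans (le_max_left _ _) hn)).1)
    (hI.mono fun n h => ⟨h.1.1, h.2.1, h.1.2.1.trans h.2.2.1.symm, h.1.2.2.trans h.2.2.2.symm⟩)
  obtain ⟨c₁, hx₁, hy₁⟩ := (hT i).exists_eq_tr hp0 (hxc i) (hyc i)
    (le_trans (le_max_left _ _) hN)
  obtain ⟨c₂, hx₂, hy₂⟩ := (hT j).exists_eq_tr hp0 (hxc j) (hyc j)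
    (le_trans (le_max_right _ _) hN)
  apply hij
  refine hdis i j (c₁ - c₂) ?_ ?_
  · rw [hx₁, hx₂, tr_tr, hXN, sub_add_cancel]
  · rw [hy₁, hy₂, tr_tr, hYN, sub_add_cancel]

/-! ### Points with prescribed addresses -/

/-- The sequence whose central block of level `m * n` is `τ^{mn}(a)`, centred according to the
digits `e t, …, e (t + n - 1)` in base `p ^ m`. -/
noncomputable def addrPt [Finite A] (τ : A → List A) (p m : ℕ) (a : A) (e : ℕ → ℤ) (t : ℕ) :
    ℤ → A :=
  (exists_limit (hyperfilter ℕ) fun n => tr (offset (p ^ m) e t n) (blk τ p (m * n) a)).choose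

lemma addrPt_spec [Finite A] (τ : A → List A) (p m : ℕ) (a : A) (e : ℕ → ℤ) (t : ℕ) (i : ℤ) :
    ∀ᶠ n in (hyperfilter ℕ : Filter ℕ),
      tr (offset (p ^ m) e t n) (blk τ p (m * n) a) i = addrPt τ p m a e t i :=
  (exists_limit (hyperfilter ℕ) fun n =>
    tr (offset (p ^ m) e t n) (blk τ p (m * n) a)).choose_spec i

/-- Digits in base `p ^ m` that are positions of `a` in `τᵐ(a)`, and whose sums leave each bounded
distance from both ends. -/
structure IsAddress (τ : A → List A) (p m : ℕ) (a : A) (e : ℕ → ℤ) : Prop where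
  nonneg : ∀ n, 0 ≤ e n
  lt : ∀ n, e n < (p ^ m : ℕ)
  return_eq : ∀ n, blk τ p m a (e n) = a
  ne_zero : ∃ᶠ n in atTop, e n ≠ 0
  ne_last : ∃ᶠ n in atTop, e n ≠ (p ^ m : ℕ) - 1

namespace IsAddress

variable {m : ℕ} {a : A} {e : ℕ → ℤ}

lemma blk_succ (hp : 0 < p) (n : ℕ) {q u : ℤ} (h0 : 0 ≤ u) (h1 : u < ((p ^ m : ℕ) : ℤ) ^ n) :
    blk τ p (m * (n + 1)) a ((p ^ m : ℕ) ^ n * q + u) = blk τ p (m * n) (blk τ p m a q) u := by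
  have h : ((p ^ m : ℕ) : ℤ) ^ n = (p : ℤ) ^ (m * n) := by push_cast; rw [pow_mul]
  rw [h] at h1 ⊢
  rw [show m * (n + 1) = m + m * n by ring, blk_add hp _ _ _ h0 h1]

/-- Since each digit is a return of `a`, the block of level `n` is the prescribed sub-block at level
`n + 1`; once a position is covered its letter no longer changes. -/
lemma apply_eq [Finite A] (h : IsAddress τ p m a e) (hp : 0 < p) (t n : ℕ) {s : ℤ}
    (h0 : 0 ≤ s + offset (p ^ m) e t n)
    (h1 : s + offset (p ^ m) e t n < ((p ^ m : ℕ) : ℤ) ^ n) :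
    addrPt τ p m a e t s = blk τ p (m * n) a (s + offset (p ^ m) e t n) := by
  have key : ∀ k, n ≤ k → (0 ≤ s + offset (p ^ m) e t k ∧
      s + offset (p ^ m) e t k < ((p ^ m : ℕ) : ℤ) ^ k) ∧
      blk τ p (m * k) a (s + offset (p ^ m) e t k) =
        blk τ p (m * n) a (s + offset (p ^ m) e t n) := by
    intro k hk
    induction k, hk using Nat.le_induction with
    | base => exact ⟨⟨h0, h1⟩, rfl⟩
    | succ k hk ih =>
      obtain ⟨⟨h2, h3⟩, h4⟩ := ih
      have h5 := h.nonneg (t + k)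
      have h6 := h.lt (t + k)
      have h7 : (0 : ℤ) < ((p ^ m : ℕ) : ℤ) ^ k := by positivity
      have h8 : 0 ≤ ((p ^ m : ℕ) : ℤ) ^ k * e (t + k) := by positivity
      rw [offset_succ]
      refine ⟨⟨by omega, by rw [pow_succ]; nlinarith⟩, ?_⟩
      rw [← h4, show ∀ u v w : ℤ, u + (v + w) = w + (u + v) by intros; ring,
        blk_succ hp k h2 h3, h.return_eq]
  obtain ⟨k, hk, hkn⟩ := ((addrPt_spec τ p m a e t s).and
    (eventually_hyperfilter (eventually_ge_atTop n))).exists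
  rw [← hk, tr_apply]
  exact (key k hkn).2

lemma apply_zero [Finite A] (h : IsAddress τ p m a e) (hp : 0 < p) (t : ℕ) :
    addrPt τ p m a e t 0 = a := by
  rw [h.apply_eq hp t 0 (by simp [offset]) (by simp [offset])]
  rfl

lemma exists_covers (h : IsAddress τ p m a e) (hp : 0 < p) (t B : ℕ) :
    ∃ n₀, ∀ n, n₀ ≤ n → B ≤ offset (p ^ m) e t n ∧
      offset (p ^ m) e t n + B < ((p ^ m : ℕ) : ℤ) ^ n := by
  have hP : 0 < p ^ m := by positivity
  obtain ⟨n₁, h1⟩ := exists_le_offset (M := 0) hP (fun n _ => h.nonneg n) h.ne_zero (Nat.zero_le t) B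
  obtain ⟨n₂, h2⟩ := exists_offset_add_lt (M := 0) hP (fun n _ => h.lt n) h.ne_last
    (Nat.zero_le t) B
  exact ⟨max n₁ n₂, fun n hn => ⟨h1 n (le_trans (le_max_left _ _) hn),
    h2 n (le_trans (le_max_right _ _) hn)⟩⟩

lemma mem [Finite A] (h : IsAddress τ p m a e) (hlen : HasConstLength τ p) (hp : 0 < p) (t : ℕ) :
    addrPt τ p m a e t ∈ subshift τ := by
  rw [mem_subshift_iff hlen hp]
  intro l r
  obtain ⟨n, hn⟩ := h.exists_covers hp t (l.natAbs + r.natAbs)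
  obtain ⟨h1, h2⟩ := hn n le_rfl
  have e1 : ((p ^ m : ℕ) : ℤ) ^ n = (p : ℤ) ^ (m * n) := by push_cast; rw [pow_mul]
  push_cast at h1 h2 e1
  have := neg_abs_le l
  have := le_abs_self r
  have := abs_nonneg l
  have := abs_nonneg r
  refine ⟨m * n, a, offset (p ^ m) e t n, by omega, by rw [← e1]; omega, fun s h3 h4 => ?_⟩
  rw [h.apply_eq hp t n (by omega) (by push_cast; omega), add_comm]

lemma eq_tr [Finite A] (h : IsAddress τ p m a e) (hp : 0 < p) (t : ℕ) :
    addrPt τ p m a e t = tr (e t) ((img τ p)^[m] (addrPt τ p m a e (t + 1))) := by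
  funext s
  obtain ⟨n₁, h1⟩ := h.exists_covers hp t s.natAbs
  obtain ⟨n₂, h2⟩ := h.exists_covers hp (t + 1) ((s + e t) / (p : ℤ) ^ m).natAbs
  obtain ⟨h3, h4⟩ := h1 (max n₁ n₂ + 1) (by omega)
  obtain ⟨h5, h6⟩ := h2 (max n₁ n₂) (le_max_right _ _)
  generalize max n₁ n₂ = n at h3 h4 h5 h6
  have e1 := h.apply_eq hp (t + 1) n (s := (s + e t) / (p : ℤ) ^ m) (by omega) (by omega)
  rw [h.apply_eq hp t (n + 1) (by omega) (by omega), tr_apply, img_iterate_congr m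
    (y := tr (offset (p ^ m) e (t + 1) n) (blk τ p (m * n) a)) (by rw [e1]; rfl),
    img_iterate_tr hp, tr_apply, offset_succ']
  rw [blk, blk, ← Function.iterate_add_apply, mul_add_one, add_comm m]
  push_cast
  ring_nf

/-- Locates the sub-blocks next to the central one: relative to the centre, the sub-block `q` is
displaced by `q - e n` lengths. The cases of interest are `q = j` for returns and `q = k` for
coincidences. -/
lemma block_eq [Finite A] (h : IsAddress τ p m a e) (hp : 0 < p) (n : ℕ) {q u : ℤ} (hq0 : 0 ≤ q)
    (hq1 : q < (p ^ m : ℕ)) (h0 : 0 ≤ u) (h1 : u < ((p ^ m : ℕ) : ℤ) ^ n) :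
    addrPt τ p m a e 0 ((p ^ m : ℕ) ^ n * (q - e n) - offset (p ^ m) e 0 n + u) =
      blk τ p (m * n) (blk τ p m a q) u := by
  have h7 : (0 : ℤ) < ((p ^ m : ℕ) : ℤ) ^ n := by positivity
  have h8 : 0 ≤ ((p ^ m : ℕ) : ℤ) ^ n * q := by positivity
  have h9 : ((p ^ m : ℕ) : ℤ) ^ n * (q - e n) - offset (p ^ m) e 0 n + u +
      offset (p ^ m) e 0 (n + 1) = ((p ^ m : ℕ) : ℤ) ^ n * q + u := by
    rw [offset_succ, zero_add]; ring
  rw [h.apply_eq hp 0 (n + 1) (by rw [h9]; omega) (by rw [h9, pow_succ]; nlinarith), h9,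
    blk_succ hp n h0 h1]

/-- Recognizability makes the difference of the first digits a multiple of `p ^ m`, hence zero; the
points of the tails are then equal, and the argument repeats. -/
lemma digit_eq [Finite A] {e' : ℕ → ℤ} (h : IsAddress τ p m a e) (h' : IsAddress τ p m a e')
    (hlen : HasConstLength τ p) (hp : 2 ≤ p) (hprim : IsPrimitive τ) (hinj : Function.Injective τ)
    (hinf : (subshift τ).Infinite) (heq : addrPt τ p m a e 0 = addrPt τ p m a e' 0) (t : ℕ) :
    addrPt τ p m a e t = addrPt τ p m a e' t ∧ e t = e' t := by
  have hp0 : 0 < p := by omega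
  have step : ∀ t, addrPt τ p m a e t = addrPt τ p m a e' t →
      addrPt τ p m a e (t + 1) = addrPt τ p m a e' (t + 1) ∧ e t = e' t := by
    intro t ht
    rw [h.eq_tr hp0, h'.eq_tr hp0] at ht
    have ht' := congrArg (tr (-e' t)) ht
    rw [tr_tr, tr_tr, neg_add_cancel, tr_zero] at ht'
    obtain ⟨q, hq, hqe⟩ := img_iterate_eq_tr hlen hp hprim hinj hinf m
      (h'.mem hlen hp0 (t + 1)) (h.mem hlen hp0 (t + 1)) ht'
    have h1 := h.nonneg t
    have h2 := h.lt t
    have h3 := h'.nonneg t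
    have h4 := h'.lt t
    push_cast at h2 h4
    have h5 : -e' t + e t = 0 :=
      Int.eq_zero_of_abs_lt_dvd ⟨q, hq⟩ (by rw [abs_lt]; constructor <;> omega)
    have h6 : q = 0 := by
      rw [h5] at hq
      rcases mul_eq_zero.1 hq.symm with h0 | h0
      · exact absurd h0 (by positivity)
      · exact h0
    rw [h6, tr_zero] at hqe
    exact ⟨hqe, by omega⟩
  have all : ∀ t, addrPt τ p m a e t = addrPt τ p m a e' t := by
    intro t
    induction t with
    | zero => exact heq
    | succ t ih => exact (step t ih).1
  exact ⟨all t, (step t (all t)).2⟩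

end IsAddress

section pairs

variable [Finite A] {m : ℕ} {a b : A} {e : ℕ → ℤ} {i j k : ℤ}

/-- At a high level with digit `i`, the sub-block at `j` copies the central one in both points at
once. -/
lemma recurrentPair_addrPt (hp : 0 < p) (ha : IsAddress τ p m a e) (hb : IsAddress τ p m b e)
    (hi : ∃ᶠ n in atTop, e n = i) (hi0 : 0 ≤ i) (hij : i < j) (hj : j < (p ^ m : ℕ))
    (haj : blk τ p m a j = a) (hbj : blk τ p m b j = b) :
    RecurrentPair (addrPt τ p m a e 0) (addrPt τ p m b e 0) := by
  intro L N
  obtain ⟨n₀, hn₀⟩ := ha.exists_covers hp 0 (L + N)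
  obtain ⟨n, hn, hen⟩ := hi.forall_exists_of_atTop n₀
  obtain ⟨h1, h2⟩ := hn₀ n hn
  push_cast at h1
  rw [Nat.cast_add] at h2
  have key : ∀ c, IsAddress τ p m c e → blk τ p m c j = c → ∀ r : ℤ, -L ≤ r → r ≤ L →
      addrPt τ p m c e 0 ((p ^ m : ℕ) ^ n * (j - i) + r) = addrPt τ p m c e 0 r := by
    intro c hc hcj r h3 h4
    have h5 := hc.block_eq hp n (q := j) (u := r + offset (p ^ m) e 0 n) (by omega) hj
      (by push_cast at *; omega) (by omega)
    rw [hcj, ← hc.apply_eq hp 0 n (by push_cast at *; omega) (by omega), hen] at h5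
    rw [← h5]
    congr 1; ring
  refine ⟨(p ^ m : ℕ) ^ n * (j - i), ?_, fun r h3 h4 => ⟨key a ha haj r h3 h4, key b hb hbj r h3 h4⟩⟩
  have h3 := offset_nonneg (p := p ^ m) (M := 0) (fun n _ => ha.nonneg n) le_rfl n
  nlinarith

lemma proximal_addrPt (hp : 0 < p) (ha : IsAddress τ p m a e) (hb : IsAddress τ p m b e)
    (hi : ∃ᶠ n in atTop, e n = i) (hi0 : 0 ≤ i) (hik : i < k) (hk : k < (p ^ m : ℕ))
    (hc : blk τ p m a k = blk τ p m b k) :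
    Proximal (addrPt τ p m a e 0) (addrPt τ p m b e 0) := by
  intro L N
  obtain ⟨n₀, hn₀⟩ := ha.exists_covers hp 0 (L + N)
  obtain ⟨n, hn, hen⟩ := hi.forall_exists_of_atTop n₀
  obtain ⟨-, h2⟩ := hn₀ n hn
  rw [Nat.cast_add] at h2
  have h3 := offset_nonneg (p := p ^ m) (M := 0) (fun n _ => ha.nonneg n) le_rfl n
  -- The window starts `N` letters inside the sub-block at `k`, which is the same in both points;
  -- this makes the position at least `N`.
  refine ⟨(p ^ m : ℕ) ^ n * (k - i) - offset (p ^ m) e 0 n + N, by nlinarith, fun r h4 h5 => ?_⟩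
  rw [← hen, add_assoc, ha.block_eq hp n (by omega) hk (by omega) (by omega),
    hb.block_eq hp n (by omega) hk (by omega) (by omega), hc]

end pairs

/-- The digits `i, j` infinitely often, and a binary sequence in between. -/
def codeDigit (i j : ℤ) (ε : ℕ → Bool) (n : ℕ) : ℤ :=
  if n % 3 = 0 then i else if n % 3 = 1 then j else if ε (n / 3) then i else j

lemma codeDigit_eq (i j : ℤ) (ε : ℕ → Bool) (n : ℕ) :
    codeDigit i j ε n = i ∨ codeDigit i j ε n = j := by
  unfold codeDigit; split_ifs <;> simp

lemma codeDigit_frequently_left (i j : ℤ) (ε : ℕ → Bool) :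
    ∃ᶠ n in atTop, codeDigit i j ε n = i :=
  frequently_atTop.2 fun n => ⟨3 * n, by omega, by simp [codeDigit]⟩

lemma codeDigit_frequently_right (i j : ℤ) (ε : ℕ → Bool) :
    ∃ᶠ n in atTop, codeDigit i j ε n = j :=
  frequently_atTop.2 fun n => ⟨3 * n + 1, by omega, by
    have h : (3 * n + 1) % 3 = 1 := by omega
    simp [codeDigit, h]⟩

lemma codeDigit_injective {i j : ℤ} (hij : i ≠ j) : Function.Injective (codeDigit i j) := by
  intro ε ε' h
  funext n
  have h1 := congrFun h (3 * n + 2)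
  have h2 : (3 * n + 2) / 3 = n := by omega
  have h5 : (3 * n + 2) % 3 = 2 := by omega
  simp only [codeDigit, h2, h5] at h1
  cases h3 : ε n <;> cases h4 : ε' n <;> simp_all [hij.symm]

theorem exists_injective_of_doubleReturn [Finite A] (hlen : HasConstLength τ p) (hp : 2 ≤ p)
    (hprim : IsPrimitive τ) (hinj : Function.Injective τ) (hinf : (subshift τ).Infinite)
    (hD : DoubleReturnCondition τ) :
    ∃ x y : (ℕ → Bool) → ℤ → A, Function.Injective x ∧ ∀ ε, x ε ∈ subshift τ ∧ y ε ∈ subshift τ ∧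
      Proximal (x ε) (y ε) ∧ NotAsymptotic (x ε) (y ε) ∧ RecurrentPair (x ε) (y ε) := by
  have hp0 : 0 < p := by omega
  obtain ⟨m, a, b, i, j, k, hab, hi0, hij, hj, hik, hk, hai, hbi, haj, hbj, hc⟩ :=
    (doubleReturn_iff hlen hp0).1 hD
  have hj' : j < (p ^ m : ℕ) := by push_cast; exact hj
  have hk' : k < (p ^ m : ℕ) := by push_cast; exact hk
  have haddr : ∀ (c : A) (ε : ℕ → Bool), blk τ p m c i = c → blk τ p m c j = c →
      IsAddress τ p m c (codeDigit i j ε) := by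
    intro c ε hci hcj
    refine ⟨fun n => ?_, fun n => ?_, fun n => ?_, ?_, ?_⟩
    · rcases codeDigit_eq i j ε n with h | h <;> omega
    · rcases codeDigit_eq i j ε n with h | h <;> omega
    · rcases codeDigit_eq i j ε n with h | h <;> rwa [h]
    · exact (codeDigit_frequently_right i j ε).mono fun n h => by omega
    · exact (codeDigit_frequently_left i j ε).mono fun n h => by omega
  refine ⟨fun ε => addrPt τ p m a (codeDigit i j ε) 0, fun ε => addrPt τ p m b (codeDigit i j ε) 0,
    fun ε ε' h => codeDigit_injective hij.ne (funext fun t => ((haddr a ε hai haj).digit_eq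
      (haddr a ε' hai haj) hlen hp hprim hinj hinf h t).2), fun ε => ?_⟩
  have ha := haddr a ε hai haj
  have hb := haddr b ε hbi hbj
  have hR := recurrentPair_addrPt hp0 ha hb (codeDigit_frequently_left i j ε) hi0 hij hj' haj hbj
  refine ⟨ha.mem hlen hp0 0, hb.mem hlen hp0 0,
    proximal_addrPt hp0 ha hb (codeDigit_frequently_left i j ε) hi0 hik hk' hc, ?_, hR⟩
  -- The letters at the centre are `a` and `b`, so each return of the centre is a difference.
  intro N
  obtain ⟨s, hs, h⟩ := hR 0 N
  obtain ⟨h1, h2⟩ := h 0 (by simp) (by simp)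
  rw [add_zero, ha.apply_zero hp0] at h1
  rw [add_zero, hb.apply_zero hp0] at h2
  exact ⟨s, hs, by dsimp only; rw [h1, h2]; exact hab⟩

/-! ### Metrics on the subshift -/

section metric

variable [TopologicalSpace A] [DiscreteTopology A] [ρ : MetricSpace (subshift τ)]

lemma tendsto_of_eventually_eq
    (hρ : ρ.toPseudoMetricSpace.toUniformSpace.toTopologicalSpace =
      TopologicalSpace.induced Subtype.val Pi.topologicalSpace)
    {ι : Type*} {U : Filter ι} {f : ι → subshift τ} {u : subshift τ}
    (h : ∀ i, ∀ᶠ n in U, (f n : ℤ → A) i = (u : ℤ → A) i) :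
    Tendsto f U (@nhds _ ρ.toPseudoMetricSpace.toUniformSpace.toTopologicalSpace u) := by
  rw [hρ, nhds_induced, tendsto_comap_iff, tendsto_pi_nhds]
  intro i
  rw [nhds_discrete, tendsto_pure]
  exact h i

lemma exists_tendsto [Finite A] (hlen : HasConstLength τ p) (hp : 0 < p)
    (hρ : ρ.toPseudoMetricSpace.toUniformSpace.toTopologicalSpace =
      TopologicalSpace.induced Subtype.val Pi.topologicalSpace) (f : ℕ → subshift τ) :
    ∃ u : subshift τ, (∀ i, ∀ᶠ n in (hyperfilter ℕ : Filter ℕ), (f n : ℤ → A) i = (u : ℤ → A) i) ∧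
      Tendsto f (hyperfilter ℕ)
        (@nhds _ ρ.toPseudoMetricSpace.toUniformSpace.toTopologicalSpace u) := by
  obtain ⟨u, hu⟩ := exists_limit (hyperfilter ℕ) fun n => (f n : ℤ → A)
  exact ⟨⟨u, limit_mem hlen hp hu fun n => (f n).2⟩, hu, tendsto_of_eventually_eq hρ hu⟩

/-- Only the topology of the metric is known, so the uniform comparison comes from compactness:
points at vanishing distance have the same limit, hence eventually equal windows. -/
lemma exists_window_of_edist_lt [Finite A] (hlen : HasConstLength τ p) (hp : 0 < p)
    (hρ : ρ.toPseudoMetricSpace.toUniformSpace.toTopologicalSpace =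
      TopologicalSpace.induced Subtype.val Pi.topologicalSpace) (L : ℕ) :
    ∃ ε : ENNReal, 0 < ε ∧ ∀ x y : subshift τ, edist x y < ε →
      ∀ i : ℤ, -L ≤ i → i ≤ L → (x : ℤ → A) i = (y : ℤ → A) i := by
  by_contra! hcon
  choose x y hxy i hi1 hi2 hne using fun n : ℕ => hcon (n : ENNReal)⁻¹ (by simp)
  obtain ⟨u, hu, hu'⟩ := exists_tendsto hlen hp hρ x
  obtain ⟨v, hv, hv'⟩ := exists_tendsto hlen hp hρ y
  have h0 : Tendsto (fun n => edist (x n) (y n)) (hyperfilter ℕ) (𝓝 0) :=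
    tendsto_of_tendsto_of_tendsto_of_le_of_le tendsto_const_nhds
      (ENNReal.tendsto_inv_nat_nhds_zero.mono_left Nat.hyperfilter_le_atTop)
      (fun n => zero_le) fun n => (hxy n).le
  have huv : u = v := edist_eq_zero.1 (tendsto_nhds_unique (hu'.edist hv') h0)
  subst huv
  obtain ⟨n, h1, h2⟩ := ((eventually_window hu (-L) (L + 1)).and
    (eventually_window hv (-L) (L + 1))).exists
  apply hne n
  rw [h1 _ (hi1 n) (by have := hi2 n; omega), h2 _ (hi1 n) (by have := hi2 n; omega)]

lemma exists_edist_lt_of_window [Finite A] (hlen : HasConstLength τ p) (hp : 0 < p)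
    (hρ : ρ.toPseudoMetricSpace.toUniformSpace.toTopologicalSpace =
      TopologicalSpace.induced Subtype.val Pi.topologicalSpace) {ε : ENNReal} (hε : 0 < ε) :
    ∃ L : ℕ, ∀ x y : subshift τ,
      (∀ i : ℤ, -L ≤ i → i ≤ L → (x : ℤ → A) i = (y : ℤ → A) i) → edist x y < ε := by
  by_contra! hcon
  choose x y hxy hle using hcon
  obtain ⟨u, hu, hu'⟩ := exists_tendsto hlen hp hρ x
  have hv' := tendsto_of_eventually_eq hρ (f := y) (u := u) (U := hyperfilter ℕ) (by
    intro i
    have hev : ∀ᶠ n : ℕ in atTop, |i| ≤ (n : ℤ) :=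
      tendsto_natCast_atTop_atTop.eventually_ge_atTop _
    filter_upwards [hu i, eventually_hyperfilter hev] with n h1 h2
    rw [← hxy n i (by have := neg_abs_le i; omega) (by have := le_abs_self i; omega), h1])
  have := hu'.edist hv'
  rw [edist_self] at this
  obtain ⟨n, hn⟩ := (this.eventually_lt_const hε).exists
  exact absurd hn (hle n).not_gt

lemma isLiYorkePair_iff [Finite A] (hlen : HasConstLength τ p) (hp : 0 < p)
    (hρ : ρ.toPseudoMetricSpace.toUniformSpace.toTopologicalSpace =
      TopologicalSpace.induced Subtype.val Pi.topologicalSpace) (z : subshift τ × subshift τ) :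
    LiYorke.IsLiYorkePair (shift τ) z ↔
      Proximal (z.1 : ℤ → A) z.2 ∧ NotAsymptotic (z.1 : ℤ → A) z.2 := by
  obtain ⟨x, y⟩ := z
  constructor
  · rintro ⟨h1, h2⟩
    refine ⟨fun L N => ?_, fun N => ?_⟩
    · obtain ⟨ε, hε, h⟩ := exists_window_of_edist_lt hlen hp hρ L
      rw [← h2] at hε
      obtain ⟨n, hn, hlt⟩ := (frequently_lt_of_liminf_lt (by isBoundedDefault) hε
        ).forall_exists_of_atTop N
      refine ⟨n, by omega, fun i h3 h4 => ?_⟩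
      have := h _ _ hlt i (by omega) (by omega)
      rwa [shift_iterate, shift_iterate, tr_apply, tr_apply, add_comm i] at this
    · obtain ⟨ε, hε, hlt⟩ := exists_between h1
      obtain ⟨L, hL⟩ := exists_edist_lt_of_window hlen hp hρ hε
      obtain ⟨n, hn, hlt'⟩ := (frequently_lt_of_lt_limsup (by isBoundedDefault) hlt
        ).forall_exists_of_atTop (N + L)
      by_contra! hcon
      refine absurd (hL _ _ fun i h3 h4 => ?_) hlt'.not_gt
      rw [shift_iterate, shift_iterate]
      exact hcon (i + n) (by omega)
  · rintro ⟨h1, h2⟩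
    constructor
    · obtain ⟨ε, hε, h⟩ := exists_window_of_edist_lt hlen hp hρ 0
      refine lt_of_lt_of_le hε (le_limsup_of_frequently_le ?_ (by isBoundedDefault))
      rw [frequently_atTop]
      intro N
      obtain ⟨s, hs, hne⟩ := h2 N
      lift s to ℕ using by omega
      refine ⟨s, by omega, ?_⟩
      by_contra! hlt
      have := h _ _ hlt 0 (by simp) (by simp)
      rw [shift_iterate, shift_iterate, tr_apply, tr_apply, zero_add] at this
      exact hne this
    · by_contra hne
      obtain ⟨ε, hε, hlt⟩ := exists_between (pos_iff_ne_zero.2 hne)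
      refine absurd hlt (not_lt.2 (liminf_le_of_frequently_le ?_ (by isBoundedDefault)))
      rw [frequently_atTop]
      intro N
      obtain ⟨L, hL⟩ := exists_edist_lt_of_window hlen hp hρ hε
      obtain ⟨s, hs, h⟩ := h1 (2 * L + 1) N
      lift s to ℕ using by omega
      -- The common window starts at `s`; its midpoint is `s + L`.
      refine ⟨s + L, by omega, (hL _ _ fun i h3 h4 => ?_).le⟩
      have := h (L + i) (by omega) (by push_cast; omega)
      rw [shift_iterate, shift_iterate, tr_apply, tr_apply]
      rw [show i + ((s + L : ℕ) : ℤ) = s + (L + i) by push_cast; ring]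
      exact this

lemma isRecurrentPt_iff [Finite A] (hlen : HasConstLength τ p) (hp : 0 < p)
    (hρ : ρ.toPseudoMetricSpace.toUniformSpace.toTopologicalSpace =
      TopologicalSpace.induced Subtype.val Pi.topologicalSpace) (z : subshift τ × subshift τ) :
    @LiYorke.IsRecurrentPt _ (@instTopologicalSpaceProd _ _
      ρ.toPseudoMetricSpace.toUniformSpace.toTopologicalSpace
      ρ.toPseudoMetricSpace.toUniformSpace.toTopologicalSpace)
      (Prod.map (shift τ) (shift τ)) z ↔ RecurrentPair (z.1 : ℤ → A) z.2 := by
  let _ : TopologicalSpace (subshift τ) :=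
    ρ.toPseudoMetricSpace.toUniformSpace.toTopologicalSpace
  obtain ⟨x, y⟩ := z
  constructor
  · intro h L N
    obtain ⟨ε, hε, hw⟩ := exists_window_of_edist_lt hlen hp hρ L
    obtain ⟨n, hn, h1, h2⟩ := (h _ (prod_mem_nhds (Metric.eball_mem_nhds x hε)
      (Metric.eball_mem_nhds y hε))).forall_exists_of_atTop N
    rw [Prod.map_iterate] at h1 h2
    refine ⟨n, by omega, fun i h3 h4 => ⟨?_, ?_⟩⟩
    · have := hw _ _ h1 i h3 h4
      simp only [Prod.map_apply, shift_iterate, tr_apply] at this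
      rwa [add_comm]
    · have := hw _ _ h2 i h3 h4
      simp only [Prod.map_apply, shift_iterate, tr_apply] at this
      rwa [add_comm]
  · intro h U hU
    obtain ⟨u, hu, v, hv, hsub⟩ := mem_nhds_prod_iff.1 hU
    obtain ⟨ε₁, hε₁, hb₁⟩ := EMetric.mem_nhds_iff.1 hu
    obtain ⟨ε₂, hε₂, hb₂⟩ := EMetric.mem_nhds_iff.1 hv
    obtain ⟨L₁, hL₁⟩ := exists_edist_lt_of_window hlen hp hρ hε₁
    obtain ⟨L₂, hL₂⟩ := exists_edist_lt_of_window hlen hp hρ hε₂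
    rw [frequently_atTop]
    intro N
    obtain ⟨s, hs, hsr⟩ := h (max L₁ L₂) N
    lift s to ℕ using by omega
    refine ⟨s, by omega, hsub ⟨hb₁ (hL₁ _ _ fun i h3 h4 => ?_), hb₂ (hL₂ _ _ fun i h3 h4 => ?_)⟩⟩
    all_goals
      rw [Prod.map_iterate]
      simp only [Prod.map_apply, shift_iterate, tr_apply]
      rw [add_comm]
    · exact (hsr i (by push_cast; omega) (by push_cast; omega)).1
    · exact (hsr i (by push_cast; omega) (by push_cast; omega)).2

lemma isStrongLiYorkePair_iff [Finite A] (hlen : HasConstLength τ p) (hp : 0 < p)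
    (hρ : ρ.toPseudoMetricSpace.toUniformSpace.toTopologicalSpace =
      TopologicalSpace.induced Subtype.val Pi.topologicalSpace) (z : subshift τ × subshift τ) :
    LiYorke.IsStrongLiYorkePair (shift τ) z ↔
      (Proximal (z.1 : ℤ → A) z.2 ∧ NotAsymptotic (z.1 : ℤ → A) z.2) ∧
        RecurrentPair (z.1 : ℤ → A) z.2 :=
  and_congr (isLiYorkePair_iff hlen hp hρ z) (isRecurrentPt_iff hlen hp hρ z)

end metric

/-! ### Powers of the shift and orbits of pairs -/

lemma shift_zpow (c : ℤ) (x : subshift τ) : ((shift τ ^ c) x : ℤ → A) = tr c x := by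
  induction c generalizing x with
  | zero => simp
  | succ i ih => rw [zpow_add_one, Equiv.Perm.mul_apply, ih, shift_apply, tr_tr]
  | pred i ih =>
    have h : ((shift τ)⁻¹ x : ℤ → A) = tr (-1) x := rfl
    rw [zpow_sub_one, Equiv.Perm.mul_apply, ih, h, tr_tr]
    rfl

end Subst

namespace LiYorke

variable {X : Type*}

lemma countable_of_countable_pairOrbit (T : Equiv.Perm X) {S : Set (X × X)}
    (h : (pairOrbit T '' S).Countable) : S.Countable := by
  refine (h.sUnion ?_).mono fun z hz => ?_
  · rintro _ ⟨z, -, rfl⟩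
    exact Set.countable_range _
  · exact ⟨_, ⟨z, hz, rfl⟩, 0, by simp⟩

lemma pairOrbit_eq_of_zpow (T : Equiv.Perm X) {z w : X × X} {c : ℤ} (h1 : z.1 = (T ^ c) w.1)
    (h2 : z.2 = (T ^ c) w.2) : pairOrbit T z = pairOrbit T w := by
  refine Set.ext fun q => ⟨?_, ?_⟩
  · rintro ⟨n, rfl⟩
    exact ⟨n + c, by simp only [h1, h2, zpow_add, Equiv.Perm.mul_apply]⟩
  · rintro ⟨n, rfl⟩
    refine ⟨n - c, ?_⟩
    simp only [h1, h2, ← Equiv.Perm.mul_apply, ← zpow_add, sub_add_cancel]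

end LiYorke

/-! ### The equivalence -/

theorem corollary3p10 {A : Type*} [Finite A] [TopologicalSpace A] [DiscreteTopology A]
    (τ : A → List A) (p : ℕ) (hp : 2 ≤ p) (hlen : Subst.HasConstLength τ p)
    (hprim : Subst.IsPrimitive τ) (hinj : Function.Injective τ)
    (hinf : (Subst.subshift τ).Infinite)
    -- any metric on the subshift that induces its topology as a subspace of the product
    [ρ : MetricSpace (Subst.subshift τ)]
    (hρ : ρ.toPseudoMetricSpace.toUniformSpace.toTopologicalSpace =
      TopologicalSpace.induced Subtype.val Pi.topologicalSpace) :
    List.TFAE [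
      ¬ (LiYorke.liYorkePairs (Subst.shift τ)).Countable,
      (LiYorke.liYorkeOrbits (Subst.shift τ)).Infinite,
      (LiYorke.strongLiYorkePairs (Subst.shift τ)).Nonempty,
      ¬ (LiYorke.strongLiYorkeOrbits (Subst.shift τ)).Countable,
      Subst.DoubleReturnCondition τ] := by
  have hp0 : 0 < p := by omega
  have hLY := Subst.isLiYorkePair_iff hlen hp0 hρ
  have hS := Subst.isStrongLiYorkePair_iff hlen hp0 hρ
  tfae_have 1 → 2 := fun h hfin =>
    h (LiYorke.countable_of_countable_pairOrbit _ (Set.Finite.countable hfin))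
  tfae_have 2 → 5 := by
    intro h
    have := h.to_subtype
    -- One representative per orbit: pairs that are common translates of each other then have the
    -- same index.
    choose z hz hzO using fun O : LiYorke.liYorkeOrbits (Subst.shift τ) => O.2
    refine Subst.doubleReturn_of_infinite hlen hp hprim hinj hinf (fun O => (z O).1.2)
      (fun O => (z O).2.2) (fun O => ((hLY _).1 (hz O)).1) (fun O => ((hLY _).1 (hz O)).2)
      fun O O' c h1 h2 => Subtype.ext ?_
    rw [← hzO O, ← hzO O']
    exact LiYorke.pairOrbit_eq_of_zpow _ (c := c)
      (Subtype.ext (h1.trans (Subst.shift_zpow _ _).symm))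
      (Subtype.ext (h2.trans (Subst.shift_zpow _ _).symm))
  tfae_have 3 → 5 := by
    rintro ⟨z, hz⟩
    obtain ⟨⟨h1, h2⟩, h3⟩ := (hS z).1 hz
    exact Subst.doubleReturn_of_recurrentPair hlen hp hprim hinj hinf z.1.2 z.2.2 h1 h2 h3
  tfae_have 5 → 4 := by
    intro hD hc
    obtain ⟨x, y, hx, hxy⟩ :=
      Subst.exists_injective_of_doubleReturn hlen hp hprim hinj hinf hD
    have hc' := LiYorke.countable_of_countable_pairOrbit _ hc
    let f : (ℕ → Bool) → LiYorke.strongLiYorkePairs (Subst.shift τ) := fun ε =>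
      ⟨(⟨x ε, (hxy ε).1⟩, ⟨y ε, (hxy ε).2.1⟩),
        (hS _).2 ⟨⟨(hxy ε).2.2.1, (hxy ε).2.2.2.1⟩, (hxy ε).2.2.2.2⟩⟩
    have hf : Function.Injective f := fun ε ε' h =>
      hx (congrArg (fun w : LiYorke.strongLiYorkePairs (Subst.shift τ) => (w.1.1 : ℤ → A)) h)
    have := hc'.to_subtype
    have := hf.countable
    -- Cantor's diagonal argument against countability of the binary sequences.
    obtain ⟨g, hg⟩ := exists_surjective_nat (ℕ → Bool)
    obtain ⟨n, hn⟩ := hg fun n => !g n n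
    simpa using congrFun hn n
  tfae_have 4 → 3 := by
    intro h
    by_contra hne
    rw [Set.not_nonempty_iff_eq_empty] at hne
    apply h
    rw [LiYorke.strongLiYorkeOrbits, hne, Set.image_empty]
    exact Set.countable_empty
  tfae_have 4 → 1 := fun h hc => h ((hc.mono fun z hz => hz.1).image _)
  tfae_finish
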